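/- Let $n\ge 1$ and let $H_{2n+1}=\mathbb{R}^{2n}\times\mathbb{R}$ be the Heisenberg group with multiplication $(x,s)\cdot(y,t)=(x+y,\,s+t+\omega(x,y))$, where $\omega$ is the standard symplectic form on $\mathbb{R}^{2n}$. Let $g$ be a left-invariant Riemannian metric on $H_{2n+1}$, and let $U_1,V_1,\dots,U_n,V_n,Z$ be a basis of the left-invariant vector fields whose only non-zero commutators are $[U_i,V_i]=Z=-[V_i,U_i]$ and in which $g$ has the diagonal matrix $\mathrm{diag}(\sigma_1,\sigma_1,\dots,\sigma_n,\sigma_n,\lambda)$ (so $\sigma_i>0$ and $\lambda>0$). Let $F$ be a $Z$-Randers metric with underlying metric $g$, that is, \[F(p,v)=\sqrt{g_p(v,v)}+g_p(Q(p),v),\] where $Q$ is a left-invariant vector field with $g(Q,Q)<1$ and $Q\in\mathrm{span}\{Z\}$; equivalently $Q=\frac{\xi}{\sqrt\lambda}Z$ with $|\xi|<1$. For a Finsler metric $F$, a non-zero tangent vector $Y$ at $p$ and a plane $P=\mathrm{span}\{X,Y\}\subset T_pM$, the flag curvature with flag pole $Y$ is \[K(P,Y)=\frac{g_Y(R(X,Y)Y,X)}{g_Y(Y,Y)\,g_Y(X,X)-g_Y(X,Y)^2},\qquad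 g_Y(X,X')=\frac12\frac{\partial^2}{\partial s\,\partial t}\Big|_{s=t=0}F^2(p,Y+sX+tX'),\] where $R$ is the (horizontal) curvature, at $(p,Y)$, of the Chern–Rund connection of $F$ on the pulled-back tangent bundle, with the sign $R(X,Y)=\nabla_X\nabla_Y-\nabla_Y\nabla_X-\nabla_{[X,Y]}$. Put $W=\frac{1}{\sqrt\lambda}Z$ and $U=\sum_{i=1}^n(a_iU_i+b_iV_i)$ with real numbers $a_i,b_i$ that are not all zero. Then at every point of $H_{2n+1}$ the flag $\Pi=\mathrm{span}\{U,W\}$ with flag pole $W$ has flag curvature \[K(\Pi,W)=\frac{\lambda}{4}\cdot\frac{\sum_{i=1}^n\frac{a_i^2+b_i^2}{\sigma_i}}{\sum_{i=1}^n(a_i^2+b_i^2)\,\sigma_i}.\] In particular $K(\Pi,W)>0$. -/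

import Mathlib

/-!
Finsler geometry in one global coordinate chart `ι → ℝ`, the Heisenberg group, and
left-invariant Randers metrics on it. A function `f x y` of a point `x` and a tangent vector `y`
is a function on the tangent bundle in its induced coordinates.
-/

noncomputable section

namespace Finsler

variable {ι : Type*} [Fintype ι] [DecidableEq ι]

/-- The partial derivative `∂f/∂xⁱ` on the tangent bundle. -/
def dX (i : ι) (f : (ι → ℝ) → (ι → ℝ) → ℝ) : (ι → ℝ) → (ι → ℝ) → ℝ :=
  fun x y => fderiv ℝ (fun x' => f x' y) x (Pi.single i 1)

/-- The partial derivative `∂f/∂yⁱ` on the tangent bundle. -/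
def dY (i : ι) (f : (ι → ℝ) → (ι → ℝ) → ℝ) : (ι → ℝ) → (ι → ℝ) → ℝ :=
  fun x y => fderiv ℝ (fun y' => f x y') y (Pi.single i 1)

variable (F : (ι → ℝ) → (ι → ℝ) → ℝ)

/-- The square `F²`. -/
def energy : (ι → ℝ) → (ι → ℝ) → ℝ := fun x y => F x y ^ 2

/-- The fundamental tensor `g_{ij} = ½ ∂²F²/∂yⁱ∂yʲ`. -/
def fundamentalTensor (x y : ι → ℝ) : Matrix ι ι ℝ :=
  Matrix.of fun i j => (1 / 2) * dY i (dY j (energy F)) x y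

/-- The osculating inner product `g_y(u, v) = g_{ij}(x, y) uⁱ vʲ`. -/
def osculating (x y u v : ι → ℝ) : ℝ :=
  ∑ i, ∑ j, fundamentalTensor F x y i j * u i * v j

/-- The geodesic spray coefficients
`Gⁱ = ¼ gⁱˡ (∂²F²/∂xᵏ∂yˡ yᵏ - ∂F²/∂xˡ)`. -/
def spray (i : ι) (x y : ι → ℝ) : ℝ :=
  (1 / 4) * ∑ l, (fundamentalTensor F x y)⁻¹ i l *
    ((∑ k, dX k (dY l (energy F)) x y * y k) - dX l (energy F) x y)

/-- The nonlinear connection `Nⁱ_j = ∂Gⁱ/∂yʲ`. -/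
def nonlinearConnection (i j : ι) (x y : ι → ℝ) : ℝ :=
  dY j (spray F i) x y

/-- The horizontal derivative `δf/δxᵏ = ∂f/∂xᵏ - Nᵐ_k ∂f/∂yᵐ`. -/
def horizontalDeriv (k : ι) (f : (ι → ℝ) → (ι → ℝ) → ℝ) (x y : ι → ℝ) : ℝ :=
  dX k f x y - ∑ m, nonlinearConnection F m k x y * dY m f x y

/-- The coefficients of the Chern–Rund connection on the pulled-back tangent bundle,
`Γⁱ_{jk} = ½ gⁱˡ (δg_{lj}/δxᵏ + δg_{lk}/δxʲ - δg_{jk}/δxˡ)`. -/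
def chern (i j k : ι) (x y : ι → ℝ) : ℝ :=
  (1 / 2) * ∑ l, (fundamentalTensor F x y)⁻¹ i l *
    (horizontalDeriv F k (fun x y => fundamentalTensor F x y l j) x y
      + horizontalDeriv F j (fun x y => fundamentalTensor F x y l k) x y
      - horizontalDeriv F l (fun x y => fundamentalTensor F x y j k) x y)

/-- The components `R_jⁱ_{kl}` of the (horizontal) curvature of the Chern–Rund connection:
`R(∂_k, ∂_l)∂_j = R_jⁱ_{kl} ∂_i`. -/
def chernCurvature (j i k l : ι) (x y : ι → ℝ) : ℝ :=
  horizontalDeriv F k (chern F i j l) x y - horizontalDeriv F l (chern F i j k) x y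
    + ∑ h, (chern F i h k x y * chern F h j l x y - chern F i h l x y * chern F h j k x y)

/-- The vector `R(u, v)w` at `(x, y)`, where
`R(u, v)w = ∇_u∇_v w - ∇_v∇_u w - ∇_{[u,v]} w` for the Chern–Rund connection. -/
def curvatureOp (x y u v w : ι → ℝ) : ι → ℝ :=
  fun i => ∑ j, ∑ k, ∑ l, chernCurvature F j i k l x y * w j * u k * v l

/-- The flag curvature at `x` of the flag `span{u, y}` with flag pole `y`. -/
def flagCurvature (x y u : ι → ℝ) : ℝ :=
  osculating F x y (curvatureOp F x y u y y) u /
    (osculating F x y y y * osculating F x y u u - osculating F x y y u ^ 2)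

end Finsler

/-- Index set of the coordinates of `ℝ²ⁿ × ℝ`, with `ℝ²ⁿ = ℝⁿ × ℝⁿ`. -/
abbrev HIdx (n : ℕ) : Type := Fin n ⊕ Fin n ⊕ Unit

/-- The coordinate space `ℝ²ⁿ × ℝ`. -/
abbrev HCoord (n : ℕ) : Type := HIdx n → ℝ

/-- The standard symplectic form on `ℝ²ⁿ` (the last coordinate is ignored). -/
def stdSymp {n : ℕ} (x y : HCoord n) : ℝ :=
  ∑ i : Fin n, (x (Sum.inl i) * y (Sum.inr (Sum.inl i))
    - x (Sum.inr (Sum.inl i)) * y (Sum.inl i))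

/-- The Heisenberg group `H_{2n+1}`, as a set `ℝ²ⁿ × ℝ`; `coord` is a global chart. -/
@[ext]
structure Heisenberg (n : ℕ) where
  coord : HCoord n

namespace Heisenberg

variable {n : ℕ}

/-- `(x, s) · (y, t) = (x + y, s + t + ω(x, y))`. -/
instance : Mul (Heisenberg n) where
  mul a b := ⟨a.coord + b.coord + Pi.single (Sum.inr (Sum.inr ())) (stdSymp a.coord b.coord)⟩

instance : One (Heisenberg n) where
  one := ⟨0⟩

instance : Inv (Heisenberg n) where
  inv a := ⟨-a.coord⟩

theorem mul_coord (a b : Heisenberg n) :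
    (a * b).coord =
      a.coord + b.coord + Pi.single (Sum.inr (Sum.inr ())) (stdSymp a.coord b.coord) := rfl

theorem one_coord : (1 : Heisenberg n).coord = 0 := rfl

theorem inv_coord (a : Heisenberg n) : (a⁻¹).coord = -a.coord := rfl

instance : Group (Heisenberg n) :=
  Group.ofLeftAxioms
    (by
      intro a b c
      ext k
      rcases k with i | i | ⟨⟩
      · simp [mul_coord, add_assoc]
      · simp [mul_coord, add_assoc]
      · simp only [mul_coord, stdSymp, Pi.add_apply, Pi.single_eq_same, ne_eq, reduceCtorEq,
          not_false_eq_true, Pi.single_eq_of_ne, add_zero, Sum.inr.injEq]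
        simp only [add_mul, mul_add, Finset.sum_add_distrib, Finset.sum_sub_distrib]
        ring)
    (by intro a; ext k; simp [mul_coord, one_coord, stdSymp])
    (by
      intro a
      ext k
      simp [mul_coord, one_coord, inv_coord, stdSymp, mul_comm])

/-- Left translation by `a`, read in the global chart. -/
def leftTranslation (a : Heisenberg n) : HCoord n → HCoord n :=
  fun p => (a * ⟨p⟩).coord

/-- A vector field `X` is left-invariant: `(dL_a)_p X_p = X_{ap}`. -/
def IsLeftInvariantField (X : HCoord n → HCoord n) : Prop :=
  ∀ (a : Heisenberg n) (p : HCoord n),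
    fderiv ℝ (leftTranslation a) p (X p) = X (leftTranslation a p)

/-- A left-invariant Riemannian metric, `L_a^* g = g`
(its smoothness is a consequence of left-invariance). -/
structure IsLeftInvariantMetric (g : HCoord n → LinearMap.BilinForm ℝ (HCoord n)) : Prop where
  symm : ∀ p u v, g p u v = g p v u
  pos : ∀ p u, u ≠ 0 → 0 < g p u u
  invariant : ∀ (a : Heisenberg n) p u v,
    g (leftTranslation a p) (fderiv ℝ (leftTranslation a) p u) (fderiv ℝ (leftTranslation a) p v)
      = g p u v

/-- `U_1, …, U_n, V_1, …, V_n, Z` is a basis of the Lie algebra of left-invariant vector fields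
whose only non-zero commutators are `[U_i, V_i] = Z` (and `[V_i, U_i] = -Z`). -/
structure IsHeisenbergFrame (U V : Fin n → HCoord n → HCoord n) (Z : HCoord n → HCoord n) :
    Prop where
  left_U : ∀ i, IsLeftInvariantField (U i)
  left_V : ∀ i, IsLeftInvariantField (V i)
  left_Z : IsLeftInvariantField Z
  linearIndependent : ∀ p, LinearIndependent ℝ
    (Sum.elim (fun i => U i p) (Sum.elim (fun i => V i p) (fun _ : Unit => Z p)))
  span_eq_top : ∀ p, Submodule.span ℝ (Set.range
    (Sum.elim (fun i => U i p) (Sum.elim (fun i => V i p) (fun _ : Unit => Z p)))) = ⊤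
  bracket_UV : ∀ i j, VectorField.lieBracket ℝ (U i) (V j) = if i = j then Z else 0
  bracket_UU : ∀ i j, VectorField.lieBracket ℝ (U i) (U j) = 0
  bracket_VV : ∀ i j, VectorField.lieBracket ℝ (V i) (V j) = 0
  bracket_UZ : ∀ i, VectorField.lieBracket ℝ (U i) Z = 0
  bracket_VZ : ∀ i, VectorField.lieBracket ℝ (V i) Z = 0

/-- In the frame `U_1, V_1, …, U_n, V_n, Z` the metric `g` has the matrix
`diag(σ_1, σ_1, …, σ_n, σ_n, lam)`. -/
structure IsDiagonalIn (g : HCoord n → LinearMap.BilinForm ℝ (HCoord n))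
    (U V : Fin n → HCoord n → HCoord n) (Z : HCoord n → HCoord n)
    (σ : Fin n → ℝ) (lam : ℝ) : Prop where
  UU : ∀ p i j, g p (U i p) (U j p) = if i = j then σ i else 0
  VV : ∀ p i j, g p (V i p) (V j p) = if i = j then σ i else 0
  UV : ∀ p i j, g p (U i p) (V j p) = 0
  UZ : ∀ p i, g p (U i p) (Z p) = 0
  VZ : ∀ p i, g p (V i p) (Z p) = 0
  ZZ : ∀ p, g p (Z p) (Z p) = lam

/-- The Randers metric `F(p, v) = √g(v, v) + g(Q(p), v)`. -/
def randers (g : HCoord n → LinearMap.BilinForm ℝ (HCoord n)) (Q : HCoord n → HCoord n) :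
    HCoord n → HCoord n → ℝ :=
  fun p v => Real.sqrt (g p v v) + g p (Q p) v

/-- `F` is a `Z`-Randers metric with underlying Riemannian metric `g`: the Randers metric of `g`
and a left-invariant vector field `Q` of length `< 1` in the span of `Z`. -/
def IsZRanders (g : HCoord n → LinearMap.BilinForm ℝ (HCoord n)) (Z : HCoord n → HCoord n)
    (F : HCoord n → HCoord n → ℝ) : Prop :=
  ∃ Q : HCoord n → HCoord n, IsLeftInvariantField Q ∧ Q ∈ Submodule.span ℝ {Z} ∧
    (∀ p, Real.sqrt (g p (Q p) (Q p)) < 1) ∧ F = randers g Q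

end Heisenberg

end

/-! Left translation moves the problem to the origin. Write h for `g` at 0, e for the central
direction, ω for the symplectic form, and v = `coframe` x y for the tangent vector y at x translated
to 0. Then F(x, y) = √h(v, v) + κ h(e, v), which is `centralRanders`. Let A be the operator with h(A
u, w) = ω(u, w). It kills e, and A u is h-orthogonal to u and to e; this gives the spray in closed
form, a scalar times the left-invariant image of A y (`spray_eq`).

For any regular F, homogeneity reduces the Chern–Rund connection to the spray G: Γ contracted with y
is N (`sum_chern_mul`), N contracted with y is 2G (`sum_nonlinearConnection_mul`), and the Jacobi
operator becomes an expression in G and N (`curvatureOp_eq`). At a central pole y = w e the spray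
vanishes and N is -μ A up to the frame, with a scalar μ, so only the quadratic term -N² survives:
R(u, y)y = -μ² A² u (`curvatureOp_center`). When the pole has h-length 1, μ² = h(e, e) F(W)², and
F(W)³ cancels between numerator and denominator of the flag curvature. The drift κ thus drops out
and h(e, e) h(A v, A v) / h(v, v) remains, v being the horizontal part of the flag
(`flagCurvature_center`).

The rest is linear algebra. Brackets at 0 are 2ω(·, ·) e (`lieBracket_zero`), so Z = c e forces
ω(U_i, V_i) = c/2, and A turns the plane of U_i, V_i by a right angle with factor c/(2σ_i)
(`map_horizontal`). With λ = c² h(e, e) this produces λ/4 and the weights 1/σ_i. -/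

open scoped ContDiff Topology

/-! ### Calculus on the slit tangent bundle. -/

namespace Finsler

section Calculus

set_option linter.unusedSectionVars false

variable {ι : Type*} [Fintype ι]

/-- Smoothness of a function on the slit tangent bundle `{y ≠ 0}`. -/
def SmoothOffZero (f : (ι → ℝ) → (ι → ℝ) → ℝ) : Prop :=
  ∀ x y, y ≠ 0 → ContDiffAt ℝ ∞ (Function.uncurry f) (x, y)

/-- The derivative of a function on the tangent bundle in the direction `ξ`. -/
noncomputable def dirDeriv (ξ : (ι → ℝ) × (ι → ℝ)) (f : (ι → ℝ) → (ι → ℝ) → ℝ) :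
    (ι → ℝ) → (ι → ℝ) → ℝ :=
  fun x y => fderiv ℝ (Function.uncurry f) (x, y) ξ

variable {f f' : (ι → ℝ) → (ι → ℝ) → ℝ}

theorem eventually_snd_ne_zero {x y : ι → ℝ} (hy : y ≠ 0) :
    ∀ᶠ q : (ι → ℝ) × (ι → ℝ) in 𝓝 (x, y), q.2 ≠ 0 :=
  continuousAt_snd.eventually_ne hy

theorem SmoothOffZero.differentiableAt (hf : SmoothOffZero f) {x y : ι → ℝ} (hy : y ≠ 0) :
    DifferentiableAt ℝ (Function.uncurry f) (x, y) :=
  (hf x y hy).differentiableAt (by simp)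

theorem uncurry_eventuallyEq (h : ∀ x y, y ≠ 0 → f x y = f' x y) {x y : ι → ℝ} (hy : y ≠ 0) :
    Function.uncurry f =ᶠ[𝓝 (x, y)] Function.uncurry f' := by
  filter_upwards [eventually_snd_ne_zero hy] with q hq
  exact h q.1 q.2 hq

theorem SmoothOffZero.congr (hf : SmoothOffZero f) (h : ∀ x y, y ≠ 0 → f' x y = f x y) :
    SmoothOffZero f' :=
  fun x y hy => (hf x y hy).congr_of_eventuallyEq (uncurry_eventuallyEq h hy)

theorem dirDeriv_congr (h : ∀ x y, y ≠ 0 → f x y = f' x y) (ξ : (ι → ℝ) × (ι → ℝ))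
    {x y : ι → ℝ} (hy : y ≠ 0) : dirDeriv ξ f x y = dirDeriv ξ f' x y := by
  unfold dirDeriv
  rw [(uncurry_eventuallyEq h hy).fderiv_eq]

theorem SmoothOffZero.dirDeriv (hf : SmoothOffZero f) (ξ : (ι → ℝ) × (ι → ℝ)) :
    SmoothOffZero (dirDeriv ξ f) := by
  intro x y hy
  have h : ContDiffAt ℝ ∞ (fderiv ℝ (Function.uncurry f)) (x, y) :=
    (hf x y hy).fderiv_right (by simp)
  exact h.clm_apply contDiffAt_const

theorem SmoothOffZero.mul (hf : SmoothOffZero f) (hf' : SmoothOffZero f') :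
    SmoothOffZero (fun x y => f x y * f' x y) :=
  fun x y hy => (hf x y hy).mul (hf' x y hy)

theorem SmoothOffZero.add (hf : SmoothOffZero f) (hf' : SmoothOffZero f') :
    SmoothOffZero (fun x y => f x y + f' x y) :=
  fun x y hy => (hf x y hy).add (hf' x y hy)

theorem SmoothOffZero.sub (hf : SmoothOffZero f) (hf' : SmoothOffZero f') :
    SmoothOffZero (fun x y => f x y - f' x y) :=
  fun x y hy => (hf x y hy).sub (hf' x y hy)

theorem SmoothOffZero.const (c : ℝ) : SmoothOffZero (fun _ _ : ι → ℝ => c) :=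
  fun _ _ _ => contDiffAt_const

theorem SmoothOffZero.const_mul (c : ℝ) (hf : SmoothOffZero f) :
    SmoothOffZero (fun x y => c * f x y) :=
  (SmoothOffZero.const c).mul hf

theorem SmoothOffZero.fiber (j : ι) : SmoothOffZero (fun _ y : ι → ℝ => y j) :=
  fun x y _ => ((contDiff_apply ℝ ℝ j).comp contDiff_snd).contDiffAt (x := (x, y))

theorem SmoothOffZero.sum {κ : Type*} {s : Finset κ} {f : κ → (ι → ℝ) → (ι → ℝ) → ℝ}
    (hf : ∀ j ∈ s, SmoothOffZero (f j)) : SmoothOffZero (fun x y => ∑ j ∈ s, f j x y) :=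
  fun x y hy => ContDiffAt.sum (f := fun j => Function.uncurry (f j)) fun j hj => hf j hj x y hy

theorem SmoothOffZero.prod {κ : Type*} {s : Finset κ} {f : κ → (ι → ℝ) → (ι → ℝ) → ℝ}
    (hf : ∀ j ∈ s, SmoothOffZero (f j)) : SmoothOffZero (fun x y => ∏ j ∈ s, f j x y) :=
  fun x y hy => contDiffAt_prod (f := fun j => Function.uncurry (f j)) fun j hj => hf j hj x y hy

theorem SmoothOffZero.inv (hf : SmoothOffZero f) (h : ∀ x y, y ≠ 0 → f x y ≠ 0) :
    SmoothOffZero (fun x y => (f x y)⁻¹) :=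
  fun x y hy => (hf x y hy).inv (h x y hy)

theorem dirDeriv_mul (hf : SmoothOffZero f) (hf' : SmoothOffZero f') (ξ : (ι → ℝ) × (ι → ℝ))
    {x y : ι → ℝ} (hy : y ≠ 0) :
    dirDeriv ξ (fun x y => f x y * f' x y) x y
      = dirDeriv ξ f x y * f' x y + f x y * dirDeriv ξ f' x y := by
  have h := (hf.differentiableAt hy (x := x)).hasFDerivAt.mul
    (hf'.differentiableAt hy (x := x)).hasFDerivAt
  have h' := congrArg (fun L => L ξ) h.fderiv
  simp only [_root_.add_apply, smul_apply, smul_eq_mul, Function.uncurry_apply_pair] at h'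
  unfold dirDeriv
  rw [show (Function.uncurry fun x y => f x y * f' x y)
    = Function.uncurry f * Function.uncurry f' from rfl, h']
  ring

theorem dirDeriv_sub (hf : SmoothOffZero f) (hf' : SmoothOffZero f') (ξ : (ι → ℝ) × (ι → ℝ))
    {x y : ι → ℝ} (hy : y ≠ 0) :
    dirDeriv ξ (fun x y => f x y - f' x y) x y = dirDeriv ξ f x y - dirDeriv ξ f' x y :=
  congrArg (fun L => L ξ) ((hf.differentiableAt hy (x := x)).hasFDerivAt.sub
    (hf'.differentiableAt hy (x := x)).hasFDerivAt).fderiv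

theorem dirDeriv_const_mul (c : ℝ) (hf : SmoothOffZero f) (ξ : (ι → ℝ) × (ι → ℝ))
    {x y : ι → ℝ} (hy : y ≠ 0) :
    dirDeriv ξ (fun x y => c * f x y) x y = c * dirDeriv ξ f x y :=
  congrArg (fun L => L ξ) ((hf.differentiableAt hy (x := x)).hasFDerivAt.const_mul c).fderiv

theorem dirDeriv_sum {κ : Type*} {s : Finset κ} {f : κ → (ι → ℝ) → (ι → ℝ) → ℝ}
    (hf : ∀ j ∈ s, SmoothOffZero (f j)) (ξ : (ι → ℝ) × (ι → ℝ)) {x y : ι → ℝ} (hy : y ≠ 0) :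
    dirDeriv ξ (fun x y => ∑ j ∈ s, f j x y) x y = ∑ j ∈ s, dirDeriv ξ (f j) x y := by
  have h := congrArg (fun L => L ξ) (HasFDerivAt.fun_sum (u := s)
    (A := fun j => Function.uncurry (f j))
    fun j hj => ((hf j hj).differentiableAt hy (x := x)).hasFDerivAt).fderiv
  simpa [dirDeriv, Function.uncurry_def] using h

theorem dirDeriv_fiber (j : ι) (ξ : (ι → ℝ) × (ι → ℝ)) (x y : ι → ℝ) :
    dirDeriv ξ (fun _ y => y j) x y = ξ.2 j := by
  have h : HasFDerivAt (Function.uncurry fun _ y : ι → ℝ => y j)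
    ((ContinuousLinearMap.proj j).comp (ContinuousLinearMap.snd ℝ (ι → ℝ) (ι → ℝ))) (x, y) :=
    ((ContinuousLinearMap.proj (R := ℝ) (φ := fun _ : ι => ℝ) j).comp
      (ContinuousLinearMap.snd ℝ (ι → ℝ) (ι → ℝ))).hasFDerivAt
  unfold dirDeriv
  rw [h.fderiv]
  rfl

theorem dirDeriv_comm (hf : SmoothOffZero f) (ξ ζ : (ι → ℝ) × (ι → ℝ)) {x y : ι → ℝ}
    (hy : y ≠ 0) : dirDeriv ξ (dirDeriv ζ f) x y = dirDeriv ζ (dirDeriv ξ f) x y := by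
  have hd : DifferentiableAt ℝ (fderiv ℝ (Function.uncurry f)) (x, y) :=
    ((hf x y hy).fderiv_right (m := ∞) (by simp)).differentiableAt (by simp)
  have key : ∀ ξ ζ : (ι → ℝ) × (ι → ℝ), dirDeriv ξ (dirDeriv ζ f) x y
      = fderiv ℝ (fderiv ℝ (Function.uncurry f)) (x, y) ξ ζ := by
    intro ξ ζ
    have h := (hd.hasFDerivAt.clm_apply (hasFDerivAt_const ζ (x, y))).fderiv
    have h' := congrArg (fun L => L ξ) h
    simpa [dirDeriv, Function.uncurry_def] using h'
  rw [key, key]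
  exact (hf x y hy).isSymmSndFDerivAt (by
    rw [minSmoothness_of_isRCLikeNormedField]; exact WithTop.coe_le_coe.2 le_top) ξ ζ

/-- The derivative in the direction `ξ` of the contraction of `f` with the fibre variable. -/
theorem dirDeriv_sum_mul_fiber {f : ι → (ι → ℝ) → (ι → ℝ) → ℝ} (hf : ∀ j, SmoothOffZero (f j))
    (ξ : (ι → ℝ) × (ι → ℝ)) {x y : ι → ℝ} (hy : y ≠ 0) :
    dirDeriv ξ (fun x y => ∑ j, f j x y * y j) x y
      = ∑ j, dirDeriv ξ (f j) x y * y j + ∑ j, f j x y * ξ.2 j := by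
  rw [dirDeriv_sum (fun j _ => (hf j).mul (SmoothOffZero.fiber j)) _ hy,
    ← Finset.sum_add_distrib]
  refine Finset.sum_congr rfl fun j _ => ?_
  rw [dirDeriv_mul (hf j) (SmoothOffZero.fiber j) _ hy, dirDeriv_fiber]

variable [DecidableEq ι]

theorem dX_eq_dirDeriv (hf : SmoothOffZero f) (i : ι) {x y : ι → ℝ} (hy : y ≠ 0) :
    dX i f x y = dirDeriv (Pi.single i 1, 0) f x y := by
  have h := (hf.differentiableAt hy (x := x)).hasFDerivAt.comp x
    (hasFDerivAt_prodMk_left (𝕜 := ℝ) x y)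
  exact congrArg (fun L => L (Pi.single i 1)) h.fderiv

theorem dY_eq_dirDeriv (hf : SmoothOffZero f) (i : ι) {x y : ι → ℝ} (hy : y ≠ 0) :
    dY i f x y = dirDeriv (0, Pi.single i 1) f x y := by
  have h := (hf.differentiableAt hy (x := x)).hasFDerivAt.comp y
    (hasFDerivAt_prodMk_right (𝕜 := ℝ) x y)
  exact congrArg (fun L => L (Pi.single i 1)) h.fderiv

theorem SmoothOffZero.dX (hf : SmoothOffZero f) (i : ι) : SmoothOffZero (dX i f) :=
  (hf.dirDeriv _).congr fun _ _ hy => dX_eq_dirDeriv hf i hy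

theorem SmoothOffZero.dY (hf : SmoothOffZero f) (i : ι) : SmoothOffZero (dY i f) :=
  (hf.dirDeriv _).congr fun _ _ hy => dY_eq_dirDeriv hf i hy

theorem dX_congr (h : ∀ x y, y ≠ 0 → f x y = f' x y) (i : ι) {x y : ι → ℝ} (hy : y ≠ 0) :
    dX i f x y = dX i f' x y := by
  unfold dX
  rw [show (fun x' => f x' y) = fun x' => f' x' y from funext fun x' => h x' y hy]

/-- A fibre derivative sees nearby y, so openness of the slit bundle is needed here; a base
derivative keeps y fixed and does not need it. -/
theorem dY_congr (h : ∀ x y, y ≠ 0 → f x y = f' x y) (i : ι) {x y : ι → ℝ} (hy : y ≠ 0) :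
    dY i f x y = dY i f' x y := by
  unfold dY
  have : (fun y' => f x y') =ᶠ[𝓝 y] fun y' => f' x y' := by
    filter_upwards [continuousAt_id.eventually_ne hy] with y' hy'
    exact h x y' hy'
  rw [this.fderiv_eq]

theorem dY_comm (hf : SmoothOffZero f) (i j : ι) {x y : ι → ℝ} (hy : y ≠ 0) :
    dY i (dY j f) x y = dY j (dY i f) x y := by
  rw [dY_eq_dirDeriv (hf.dY j) i hy, dY_eq_dirDeriv (hf.dY i) j hy,
    dirDeriv_congr (fun _ _ h => dY_eq_dirDeriv hf j h) _ hy,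
    dirDeriv_congr (fun _ _ h => dY_eq_dirDeriv hf i h) _ hy, dirDeriv_comm hf _ _ hy]

theorem dX_dY_comm (hf : SmoothOffZero f) (i j : ι) {x y : ι → ℝ} (hy : y ≠ 0) :
    dX i (dY j f) x y = dY j (dX i f) x y := by
  rw [dX_eq_dirDeriv (hf.dY j) i hy, dY_eq_dirDeriv (hf.dX i) j hy,
    dirDeriv_congr (fun _ _ h => dY_eq_dirDeriv hf j h) _ hy,
    dirDeriv_congr (fun _ _ h => dX_eq_dirDeriv hf i h) _ hy, dirDeriv_comm hf _ _ hy]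

theorem dX_sum_mul_fiber {f : ι → (ι → ℝ) → (ι → ℝ) → ℝ} (hf : ∀ j, SmoothOffZero (f j))
    (k : ι) {x y : ι → ℝ} (hy : y ≠ 0) :
    dX k (fun x y => ∑ j, f j x y * y j) x y = ∑ j, dX k (f j) x y * y j := by
  rw [dX_eq_dirDeriv (.sum fun j _ => (hf j).mul (.fiber j)) k hy,
    dirDeriv_sum_mul_fiber hf _ hy]
  simp [dX_eq_dirDeriv (hf _) k hy]

theorem dY_sum_mul_fiber {f : ι → (ι → ℝ) → (ι → ℝ) → ℝ} (hf : ∀ j, SmoothOffZero (f j))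
    (k : ι) {x y : ι → ℝ} (hy : y ≠ 0) :
    dY k (fun x y => ∑ j, f j x y * y j) x y = ∑ j, dY k (f j) x y * y j + f k x y := by
  rw [dY_eq_dirDeriv (.sum fun j _ => (hf j).mul (.fiber j)) k hy,
    dirDeriv_sum_mul_fiber hf _ hy]
  simp [dY_eq_dirDeriv (hf _) k hy, Pi.single_apply]

theorem dX_const_mul (c : ℝ) (hf : SmoothOffZero f) (k : ι) {x y : ι → ℝ} (hy : y ≠ 0) :
    dX k (fun x y => c * f x y) x y = c * dX k f x y := by
  rw [dX_eq_dirDeriv (hf.const_mul c) k hy, dX_eq_dirDeriv hf k hy, dirDeriv_const_mul c hf _ hy]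

theorem dY_const_mul (c : ℝ) (hf : SmoothOffZero f) (k : ι) {x y : ι → ℝ} (hy : y ≠ 0) :
    dY k (fun x y => c * f x y) x y = c * dY k f x y := by
  rw [dY_eq_dirDeriv (hf.const_mul c) k hy, dY_eq_dirDeriv hf k hy, dirDeriv_const_mul c hf _ hy]

theorem dY_sub (hf : SmoothOffZero f) (hf' : SmoothOffZero f') (k : ι) {x y : ι → ℝ}
    (hy : y ≠ 0) : dY k (fun x y => f x y - f' x y) x y = dY k f x y - dY k f' x y := by
  rw [dY_eq_dirDeriv (hf.sub hf') k hy, dY_eq_dirDeriv hf k hy, dY_eq_dirDeriv hf' k hy,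
    dirDeriv_sub hf hf' _ hy]

theorem dY_sum_mul {κ : Type*} {s : Finset κ} {f f' : κ → (ι → ℝ) → (ι → ℝ) → ℝ}
    (hf : ∀ j, SmoothOffZero (f j)) (hf' : ∀ j, SmoothOffZero (f' j)) (k : ι) {x y : ι → ℝ}
    (hy : y ≠ 0) : dY k (fun x y => ∑ j ∈ s, f j x y * f' j x y) x y
      = ∑ j ∈ s, (dY k (f j) x y * f' j x y + f j x y * dY k (f' j) x y) := by
  rw [dY_eq_dirDeriv (.sum fun j _ => (hf j).mul (hf' j)) k hy,
    dirDeriv_sum (fun j _ => (hf j).mul (hf' j)) _ hy]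
  refine Finset.sum_congr rfl fun j _ => ?_
  rw [dirDeriv_mul (hf j) (hf' j) _ hy, dY_eq_dirDeriv (hf j) k hy, dY_eq_dirDeriv (hf' j) k hy]

end Calculus

end Finsler

/-! ### From the Chern–Rund connection to the spray, for a general regular F. -/

namespace Finsler

section Spray

variable {ι : Type*} [Fintype ι]

theorem SmoothOffZero.det {κ : Type*} [Fintype κ] [DecidableEq κ]
    {M : (ι → ℝ) → (ι → ℝ) → Matrix κ κ ℝ} (hM : ∀ i j, SmoothOffZero fun x y => M x y i j) :
    SmoothOffZero fun x y => (M x y).det := by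
  simp only [Matrix.det_apply']
  exact .sum fun s _ => .const_mul _ (.prod fun i _ => hM _ _)

variable [DecidableEq ι]

/-- Cramer's rule: the entries of the inverse are quotients of determinants. -/
theorem SmoothOffZero.matrix_inv {M : (ι → ℝ) → (ι → ℝ) → Matrix ι ι ℝ}
    (hM : ∀ i j, SmoothOffZero fun x y => M x y i j)
    (hdet : ∀ x y, y ≠ 0 → (M x y).det ≠ 0) (i j : ι) :
    SmoothOffZero fun x y => (M x y)⁻¹ i j := by
  simp only [Matrix.inv_def, Ring.inverse_eq_inv', Matrix.smul_apply, smul_eq_mul,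
    Matrix.adjugate_apply]
  refine ((SmoothOffZero.det hM).inv hdet).mul (SmoothOffZero.det fun k l => ?_)
  simp only [Matrix.updateRow_apply]
  split
  · exact .const _
  · exact hM k l

/-- A Finsler function up to positivity: `F²` is smooth and positively `2`-homogeneous
(in the form of Euler's identity) off the zero section, with non-degenerate fundamental tensor. -/
structure IsRegular (F : (ι → ℝ) → (ι → ℝ) → ℝ) : Prop where
  smooth : SmoothOffZero (energy F)
  euler : ∀ x y, y ≠ 0 → ∑ j, dY j (energy F) x y * y j = 2 * energy F x y
  det_ne_zero : ∀ x y, y ≠ 0 → (fundamentalTensor F x y).det ≠ 0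

variable {F : (ι → ℝ) → (ι → ℝ) → ℝ}

/-- The Leibniz rule, with δyʲ/δxᵏ = -Nʲ_k as the source of the second sum. -/
theorem horizontalDeriv_sum_mul_fiber {f : ι → (ι → ℝ) → (ι → ℝ) → ℝ} {x y : ι → ℝ}
    (hf : ∀ j, SmoothOffZero (f j)) (hy : y ≠ 0) (k : ι) :
    horizontalDeriv F k (fun x y => ∑ j, f j x y * y j) x y
      = ∑ j, horizontalDeriv F k (f j) x y * y j
        - ∑ j, f j x y * nonlinearConnection F j k x y := by
  unfold horizontalDeriv
  rw [dX_sum_mul_fiber hf k hy]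
  simp only [dY_sum_mul_fiber hf _ hy, mul_add, sub_mul, Finset.sum_add_distrib,
    Finset.sum_sub_distrib, Finset.sum_mul, Finset.mul_sum]
  rw [Finset.sum_comm (f := fun j m => nonlinearConnection F m k x y * dY m (f j) x y * y j)]
  simp only [mul_assoc, mul_comm (nonlinearConnection F _ k x y) (f _ x y)]
  ring

namespace IsRegular

theorem smooth_fundamentalTensor (hF : IsRegular F) (i j : ι) :
    SmoothOffZero fun x y => fundamentalTensor F x y i j :=
  ((hF.smooth.dY j).dY i).const_mul _

theorem smooth_inv (hF : IsRegular F) (i j : ι) :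
    SmoothOffZero fun x y => (fundamentalTensor F x y)⁻¹ i j :=
  .matrix_inv hF.smooth_fundamentalTensor hF.det_ne_zero i j

theorem smooth_sprayCovector (hF : IsRegular F) (l : ι) : SmoothOffZero fun x y =>
    (∑ k, dX k (dY l (energy F)) x y * y k) - dX l (energy F) x y :=
  .sub (.sum fun k _ => ((hF.smooth.dY l).dX k).mul (.fiber k)) (hF.smooth.dX l)

theorem smooth_spray (hF : IsRegular F) (i : ι) : SmoothOffZero (spray F i) :=
  .const_mul _ (.sum fun l _ => (hF.smooth_inv i l).mul (hF.smooth_sprayCovector l))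

theorem smooth_nonlinearConnection (hF : IsRegular F) (i j : ι) :
    SmoothOffZero (nonlinearConnection F i j) :=
  (hF.smooth_spray i).dY j

theorem smooth_horizontalDeriv (hF : IsRegular F) (k : ι) {f : (ι → ℝ) → (ι → ℝ) → ℝ}
    (hf : SmoothOffZero f) : SmoothOffZero (horizontalDeriv F k f) :=
  .sub (hf.dX k) (.sum fun m _ => (hF.smooth_nonlinearConnection m k).mul (hf.dY m))

theorem smooth_chern (hF : IsRegular F) (i j k : ι) : SmoothOffZero (chern F i j k) :=
  .const_mul _ (.sum fun l _ => (hF.smooth_inv i l).mul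
    (((hF.smooth_horizontalDeriv k (hF.smooth_fundamentalTensor l j)).add
      (hF.smooth_horizontalDeriv j (hF.smooth_fundamentalTensor l k))).sub
      (hF.smooth_horizontalDeriv l (hF.smooth_fundamentalTensor j k))))

variable {x y : ι → ℝ}

theorem fundamentalTensor_comm (hF : IsRegular F) (hy : y ≠ 0) (i j : ι) :
    fundamentalTensor F x y i j = fundamentalTensor F x y j i := by
  simp only [fundamentalTensor, Matrix.of_apply]
  rw [dY_comm hF.smooth i j hy]

/-- The fibre derivative of Euler's identity for F². -/
theorem sum_fundamentalTensor_mul (hF : IsRegular F) (hy : y ≠ 0) (l : ι) :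
    ∑ j, fundamentalTensor F x y l j * y j = 1 / 2 * dY l (energy F) x y := by
  have h := dY_congr hF.euler l (x := x) hy
  rw [dY_sum_mul_fiber (fun j => hF.smooth.dY j) l hy, dY_const_mul 2 hF.smooth l hy] at h
  simp only [fundamentalTensor, Matrix.of_apply, mul_assoc, ← Finset.mul_sum]
  linarith

/-- The Cartan tensor annihilates y: one more fibre derivative of the preceding contraction. This
removes the Cartan terms in the later contractions with y. -/
theorem sum_dY_fundamentalTensor_mul (hF : IsRegular F) (hy : y ≠ 0) (m l : ι) :
    ∑ j, dY m (fun x y => fundamentalTensor F x y l j) x y * y j = 0 := by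
  have h := dY_congr (fun x y hy => hF.sum_fundamentalTensor_mul hy l (x := x)) m (x := x) hy
  rw [dY_sum_mul_fiber (hF.smooth_fundamentalTensor l) m hy,
    dY_const_mul _ (hF.smooth.dY l) m hy, hF.fundamentalTensor_comm hy] at h
  simpa [fundamentalTensor] using h

theorem sum_dX_fundamentalTensor_mul (hF : IsRegular F) (hy : y ≠ 0) (k l : ι) :
    ∑ j, dX k (fun x y => fundamentalTensor F x y l j) x y * y j
      = 1 / 2 * dX k (dY l (energy F)) x y := by
  have h := dX_congr (fun x y hy => hF.sum_fundamentalTensor_mul hy l (x := x)) k (x := x) hy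
  rwa [dX_sum_mul_fiber (hF.smooth_fundamentalTensor l) k hy,
    dX_const_mul _ (hF.smooth.dY l) k hy] at h

theorem sum_fundamentalTensor_mul_inv (hF : IsRegular F) (hy : y ≠ 0) (v : ι → ℝ) (l : ι) :
    ∑ i, fundamentalTensor F x y l i * ∑ m, (fundamentalTensor F x y)⁻¹ i m * v m = v l := by
  have h := congrFun (Matrix.mulVec_mulVec v (fundamentalTensor F x y)
    (fundamentalTensor F x y)⁻¹) l
  rw [Matrix.mul_nonsing_inv _ (hF.det_ne_zero x y hy).isUnit, Matrix.one_mulVec] at h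
  exact h

/-- A vector is determined by its contraction with the fundamental tensor. -/
theorem ext_of_lower (hF : IsRegular F) (hy : y ≠ 0) {v w : ι → ℝ}
    (h : ∀ l, ∑ i, fundamentalTensor F x y l i * v i = ∑ i, fundamentalTensor F x y l i * w i) :
    v = w := by
  refine Matrix.mulVec_injective_of_isUnit
    ((Matrix.isUnit_iff_isUnit_det _).2 (hF.det_ne_zero x y hy).isUnit) (funext h)

theorem sum_fundamentalTensor_mul_spray (hF : IsRegular F) (hy : y ≠ 0) (l : ι) :
    ∑ i, fundamentalTensor F x y l i * spray F i x y
      = 1 / 4 * ((∑ k, dX k (dY l (energy F)) x y * y k) - dX l (energy F) x y) := by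
  rw [← hF.sum_fundamentalTensor_mul_inv hy (fun l =>
    (∑ k, dX k (dY l (energy F)) x y * y k) - dX l (energy F) x y) l, Finset.mul_sum]
  refine Finset.sum_congr rfl fun i _ => ?_
  unfold spray
  ring

theorem dX_fundamentalTensor (hF : IsRegular F) (hy : y ≠ 0) (k l m : ι) :
    dX m (fun x y => fundamentalTensor F x y k l) x y
      = 1 / 2 * dY k (dX m (dY l (energy F))) x y := by
  rw [← dX_dY_comm (hF.smooth.dY l) m k hy]
  exact dX_const_mul _ ((hF.smooth.dY l).dY k) m hy

/-- Obtained by differentiating the lowered spray in the fibre and moving the term with ∂g/∂y to the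
right. Working with a lowered index avoids differentiating the inverse matrix. -/
theorem sum_fundamentalTensor_mul_nonlinearConnection (hF : IsRegular F) (hy : y ≠ 0)
    (l k : ι) :
    ∑ i, fundamentalTensor F x y l i * nonlinearConnection F i k x y
      = 1 / 4 * (dX k (dY l (energy F)) x y - dX l (dY k (energy F)) x y)
        + 1 / 2 * ∑ m, dX m (fun x y => fundamentalTensor F x y l k) x y * y m
        - ∑ m, spray F m x y * dY m (fun x y => fundamentalTensor F x y l k) x y := by
  have h := dY_congr (fun x y hy => hF.sum_fundamentalTensor_mul_spray hy l (x := x)) k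
    (x := x) hy
  rw [dY_sum_mul (hF.smooth_fundamentalTensor l) hF.smooth_spray k hy,
    dY_const_mul _ (hF.smooth_sprayCovector l) k hy,
    dY_sub (.sum fun k _ => ((hF.smooth.dY l).dX k).mul (.fiber k)) (hF.smooth.dX l) k hy,
    dY_sum_mul_fiber (fun k => (hF.smooth.dY l).dX k) k hy, Finset.sum_add_distrib,
    ← dX_dY_comm hF.smooth l k hy] at h
  have h1 : ∑ m, dX m (fun x y => fundamentalTensor F x y l k) x y * y m
      = 1 / 2 * ∑ m, dY k (dX m (dY l (energy F))) x y * y m := by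
    rw [Finset.mul_sum]
    refine Finset.sum_congr rfl fun m _ => ?_
    rw [dX_congr (fun x y hy => hF.fundamentalTensor_comm hy l k) m hy,
      hF.dX_fundamentalTensor hy]
    ring
  have h2 : ∑ m, spray F m x y * dY m (fun x y => fundamentalTensor F x y l k) x y
      = ∑ m, dY k (fun x y => fundamentalTensor F x y l m) x y * spray F m x y := by
    refine Finset.sum_congr rfl fun m _ => ?_
    -- The Cartan tensor is totally symmetric, since third fibre derivatives of F² commute.
    have e : dY m (fun x y => fundamentalTensor F x y l k) x y
        = dY k (fun x y => fundamentalTensor F x y l m) x y := by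
      rw [dY_congr (fun x y hy => hF.fundamentalTensor_comm hy l k) m hy,
        dY_congr (fun x y hy => hF.fundamentalTensor_comm hy l m) k hy]
      exact (dY_const_mul _ ((hF.smooth.dY l).dY k) m hy).trans
        ((congrArg _ (dY_comm (hF.smooth.dY l) m k hy)).trans
          (dY_const_mul _ ((hF.smooth.dY l).dY m) k hy).symm)
    rw [e]
    ring
  unfold nonlinearConnection
  rw [h1, h2]
  linarith

/-- Euler's identity for the spray, homogeneous of degree 2. It is checked after lowering the index,
where it follows from Euler's identity for F² and the vanishing of Cartan contractions. -/
theorem sum_nonlinearConnection_mul (hF : IsRegular F) (hy : y ≠ 0) (i : ι) :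
    ∑ k, nonlinearConnection F i k x y * y k = 2 * spray F i x y := by
  refine congrFun (hF.ext_of_lower (v := fun i => ∑ k, nonlinearConnection F i k x y * y k)
    (w := fun i => 2 * spray F i x y) (x := x) hy fun l => ?_) i
  have h1 : ∑ i, fundamentalTensor F x y l i * ∑ k, nonlinearConnection F i k x y * y k
      = ∑ k, (∑ i, fundamentalTensor F x y l i * nonlinearConnection F i k x y) * y k := by
    simp only [Finset.mul_sum, Finset.sum_mul]
    rw [Finset.sum_comm]
    exact Finset.sum_congr rfl fun k _ => Finset.sum_congr rfl fun i _ => by ring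
  have h2 : ∑ k, (∑ m, dX m (fun x y => fundamentalTensor F x y l k) x y * y m) * y k
      = 1 / 2 * ∑ m, dX m (dY l (energy F)) x y * y m := by
    simp only [Finset.sum_mul]
    rw [Finset.sum_comm, Finset.mul_sum]
    refine Finset.sum_congr rfl fun m _ => ?_
    rw [← mul_assoc, ← hF.sum_dX_fundamentalTensor_mul hy m l, Finset.sum_mul]
    exact Finset.sum_congr rfl fun k _ => by ring
  have h3 : ∑ k, (∑ m, spray F m x y * dY m (fun x y => fundamentalTensor F x y l k) x y) * y k
      = 0 := by
    simp only [Finset.sum_mul]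
    rw [Finset.sum_comm]
    refine Finset.sum_eq_zero fun m _ => ?_
    simp only [mul_assoc]
    rw [← Finset.mul_sum, hF.sum_dY_fundamentalTensor_mul hy m l, mul_zero]
  have h4 : ∑ k, dX l (dY k (energy F)) x y * y k = 2 * dX l (energy F) x y := by
    rw [← dX_sum_mul_fiber (fun k => hF.smooth.dY k) l hy, dX_congr hF.euler l hy,
      dX_const_mul _ hF.smooth l hy]
  have h5 : ∑ i, fundamentalTensor F x y l i * (2 * spray F i x y)
      = 2 * ∑ i, fundamentalTensor F x y l i * spray F i x y := by
    rw [Finset.mul_sum]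
    exact Finset.sum_congr rfl fun i _ => by ring
  rw [h1, h5, hF.sum_fundamentalTensor_mul_spray hy]
  simp only [hF.sum_fundamentalTensor_mul_nonlinearConnection hy]
  simp only [sub_mul, add_mul, mul_assoc, Finset.sum_sub_distrib, Finset.sum_add_distrib,
    ← Finset.mul_sum]
  rw [h2, h3, h4]
  ring

/-- Contracting the Chern–Rund connection with `y` gives the nonlinear connection. -/
theorem sum_chern_mul (hF : IsRegular F) (hy : y ≠ 0) (i k : ι) :
    ∑ j, chern F i j k x y * y j = nonlinearConnection F i k x y := by
  refine congrFun (hF.ext_of_lower (v := fun i => ∑ j, chern F i j k x y * y j)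
    (w := fun i => nonlinearConnection F i k x y) (x := x) hy fun l => ?_) i
  -- When y is contracted with an index of g, the vertical part of δ contributes only a Cartan
  -- contraction, which is zero.
  have hA : ∀ k l, ∑ j, horizontalDeriv F k (fun x y => fundamentalTensor F x y l j) x y * y j
      = 1 / 2 * dX k (dY l (energy F)) x y := by
    intro k l
    simp only [horizontalDeriv, sub_mul, Finset.sum_sub_distrib, Finset.sum_mul]
    rw [hF.sum_dX_fundamentalTensor_mul hy, Finset.sum_comm, sub_eq_self]
    refine Finset.sum_eq_zero fun m _ => ?_
    simp only [mul_assoc]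
    rw [← Finset.mul_sum, hF.sum_dY_fundamentalTensor_mul hy m l, mul_zero]
  -- Here y meets the index of differentiation, so the vertical part survives and N y = 2G turns it
  -- into a spray term.
  have hB : ∑ j, horizontalDeriv F j (fun x y => fundamentalTensor F x y l k) x y * y j
      = ∑ j, dX j (fun x y => fundamentalTensor F x y l k) x y * y j
        - 2 * ∑ m, spray F m x y * dY m (fun x y => fundamentalTensor F x y l k) x y := by
    simp only [horizontalDeriv, sub_mul, Finset.sum_sub_distrib, Finset.sum_mul]
    rw [Finset.sum_comm, Finset.mul_sum]
    congr 1
    refine Finset.sum_congr rfl fun m _ => ?_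
    rw [← mul_assoc, ← hF.sum_nonlinearConnection_mul hy, Finset.sum_mul]
    exact Finset.sum_congr rfl fun j _ => by ring
  have hC : ∑ j, horizontalDeriv F l (fun x y => fundamentalTensor F x y j k) x y * y j
      = 1 / 2 * dX l (dY k (energy F)) x y := by
    rw [← hA l k]
    refine Finset.sum_congr rfl fun j _ => ?_
    unfold horizontalDeriv
    rw [dX_congr (fun x y hy => hF.fundamentalTensor_comm hy j k) l hy]
    simp only [dY_congr (fun x y hy => hF.fundamentalTensor_comm hy j k) _ hy]
  have h1 : ∀ i, ∑ j, chern F i j k x y * y j = ∑ m, (fundamentalTensor F x y)⁻¹ i m *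
      (1 / 2 * ∑ j, (horizontalDeriv F k (fun x y => fundamentalTensor F x y m j) x y
        + horizontalDeriv F j (fun x y => fundamentalTensor F x y m k) x y
        - horizontalDeriv F m (fun x y => fundamentalTensor F x y j k) x y) * y j) := by
    intro i
    simp only [chern, Finset.mul_sum, Finset.sum_mul]
    rw [Finset.sum_comm]
    exact Finset.sum_congr rfl fun m _ => Finset.sum_congr rfl fun j _ => by ring
  simp only [h1]
  rw [hF.sum_fundamentalTensor_mul_inv hy (fun m => 1 / 2 *
    ∑ j, (horizontalDeriv F k (fun x y => fundamentalTensor F x y m j) x y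
        + horizontalDeriv F j (fun x y => fundamentalTensor F x y m k) x y
        - horizontalDeriv F m (fun x y => fundamentalTensor F x y j k) x y) * y j) l,
    hF.sum_fundamentalTensor_mul_nonlinearConnection hy]
  simp only [sub_mul, add_mul, Finset.sum_sub_distrib, Finset.sum_add_distrib]
  rw [hA, hB, hC]
  ring

/-- `yʲ R_jⁱ_{kl} = δNⁱ_l/δxᵏ - δNⁱ_k/δxˡ`. -/
theorem sum_chernCurvature_mul (hF : IsRegular F) (hy : y ≠ 0) (i k l : ι) :
    ∑ j, chernCurvature F j i k l x y * y j
      = horizontalDeriv F k (nonlinearConnection F i l) x y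
        - horizontalDeriv F l (nonlinearConnection F i k) x y := by
  -- Apply δ to N = Γ y; the correction Γ N coming from δy is exactly what the ΓΓ terms of the
  -- curvature contract to.
  have key : ∀ k l, horizontalDeriv F k (nonlinearConnection F i l) x y
      = ∑ j, horizontalDeriv F k (chern F i j l) x y * y j
        - ∑ j, chern F i j l x y * nonlinearConnection F j k x y := by
    intro k l
    rw [← horizontalDeriv_sum_mul_fiber (fun j => hF.smooth_chern i j l) hy k]
    unfold horizontalDeriv
    rw [dX_congr (fun x y hy => (hF.sum_chern_mul hy i l (x := x)).symm) k hy]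
    simp only [dY_congr (fun x y hy => (hF.sum_chern_mul hy i l (x := x)).symm) _ hy]
  have h : ∀ k l, ∑ j, (∑ h, chern F i h k x y * chern F h j l x y) * y j
      = ∑ h, chern F i h k x y * nonlinearConnection F h l x y := by
    intro k l
    simp only [Finset.sum_mul]
    rw [Finset.sum_comm]
    refine Finset.sum_congr rfl fun h _ => ?_
    rw [← hF.sum_chern_mul hy, Finset.mul_sum]
    exact Finset.sum_congr rfl fun j _ => by ring
  simp only [chernCurvature, Finset.sum_sub_distrib, add_mul, sub_mul, Finset.sum_add_distrib]
  rw [h, h, key, key]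
  ring

/-- The Jacobi operator in terms of the spray alone. -/
theorem curvatureOp_eq (hF : IsRegular F) (hy : y ≠ 0) (u : ι → ℝ) (i : ι) :
    curvatureOp F x y u y y i = ∑ k, (2 * dX k (spray F i) x y
      - ∑ l, dX l (nonlinearConnection F i k) x y * y l
      + 2 * ∑ m, spray F m x y * dY m (nonlinearConnection F i k) x y
      - ∑ m, nonlinearConnection F i m x y * nonlinearConnection F m k x y) * u k := by
  have h0 : curvatureOp F x y u y y i
      = ∑ k, (∑ l, (∑ j, chernCurvature F j i k l x y * y j) * y l) * u k := by
    unfold curvatureOp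
    simp only [Finset.sum_mul]
    rw [Finset.sum_comm]
    refine Finset.sum_congr rfl fun k _ => ?_
    rw [Finset.sum_comm]
    exact Finset.sum_congr rfl fun l _ => Finset.sum_congr rfl fun j _ => by ring
  rw [h0]
  refine Finset.sum_congr rfl fun k _ => ?_
  congr 1
  simp only [hF.sum_chernCurvature_mul hy, sub_mul, Finset.sum_sub_distrib]
  have h1 : ∑ l, horizontalDeriv F k (nonlinearConnection F i l) x y * y l
      = 2 * dX k (spray F i) x y
        - ∑ m, nonlinearConnection F i m x y * nonlinearConnection F m k x y := by
    have e := horizontalDeriv_sum_mul_fiber (F := F) (hF.smooth_nonlinearConnection i) hy k (x := x)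
    -- The same contraction computed through N y = 2G; comparison with the Leibniz rule isolates the
    -- wanted sum, leaving one of the two N N terms.
    have e' : horizontalDeriv F k (fun x y => ∑ j, nonlinearConnection F i j x y * y j) x y
        = 2 * dX k (spray F i) x y
          - 2 * ∑ m, nonlinearConnection F i m x y * nonlinearConnection F m k x y := by
      unfold horizontalDeriv
      rw [dX_congr (fun x y hy => hF.sum_nonlinearConnection_mul hy i (x := x)) k hy,
        dX_const_mul _ (hF.smooth_spray i) k hy, Finset.mul_sum]
      congr 1
      refine Finset.sum_congr rfl fun m _ => ?_
      rw [dY_congr (fun x y hy => hF.sum_nonlinearConnection_mul hy i (x := x)) m hy,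
        dY_const_mul _ (hF.smooth_spray i) m hy]
      change _ * (2 * nonlinearConnection F i m x y) = _
      ring
    rw [e'] at e
    linarith
  have h2 : ∑ l, horizontalDeriv F l (nonlinearConnection F i k) x y * y l
      = ∑ l, dX l (nonlinearConnection F i k) x y * y l
        - 2 * ∑ m, spray F m x y * dY m (nonlinearConnection F i k) x y := by
    simp only [horizontalDeriv, sub_mul, Finset.sum_sub_distrib, Finset.sum_mul]
    rw [Finset.sum_comm, Finset.mul_sum]
    congr 1
    refine Finset.sum_congr rfl fun m _ => ?_
    rw [← mul_assoc, ← hF.sum_nonlinearConnection_mul hy, Finset.sum_mul]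
    exact Finset.sum_congr rfl fun j _ => by ring
  rw [h1, h2]
  ring

end IsRegular

end Spray

end Finsler

/-! ### Partial derivatives computed along lines. -/

namespace Finsler

section LineDerivatives

variable {ι : Type*} [Fintype ι] [DecidableEq ι]

theorem sum_apply_single_mul (f : (ι → ℝ) →ₗ[ℝ] ℝ) (v : ι → ℝ) :
    ∑ i, f (Pi.single i 1) * v i = f v := by
  conv_rhs => rw [pi_eq_sum_univ' v, map_sum]
  refine Finset.sum_congr rfl fun i _ => ?_
  rw [map_smul, smul_eq_mul, mul_comm]

/-- Smoothness is known beforehand, so a one-variable derivative along a line identifies the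
contraction of the partials with v. -/
theorem sum_dX_mul_eq_of_hasDerivAt {f : (ι → ℝ) → (ι → ℝ) → ℝ} (hf : SmoothOffZero f)
    {x y : ι → ℝ} (hy : y ≠ 0) {v : ι → ℝ} {c : ℝ}
    (h : HasDerivAt (fun t : ℝ => f (x + t • v) y) c 0) : ∑ k, dX k f x y * v k = c := by
  have hd : DifferentiableAt ℝ (fun x' => f x' y) x :=
    (hf.differentiableAt hy (x := x)).comp (f := fun x' => (x', y)) x
      (hasFDerivAt_prodMk_left (𝕜 := ℝ) x y).differentiableAt
  exact (sum_apply_single_mul (fderiv ℝ (fun x' => f x' y) x).toLinearMap v).trans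
    ((hd.hasFDerivAt.hasLineDerivAt v).unique h)

theorem sum_dY_mul_eq_of_hasDerivAt {f : (ι → ℝ) → (ι → ℝ) → ℝ} (hf : SmoothOffZero f)
    {x y : ι → ℝ} (hy : y ≠ 0) {v : ι → ℝ} {c : ℝ}
    (h : HasDerivAt (fun t : ℝ => f x (y + t • v)) c 0) : ∑ k, dY k f x y * v k = c := by
  have hd : DifferentiableAt ℝ (fun y' => f x y') y :=
    (hf.differentiableAt hy (x := x)).comp (f := fun y' => (x, y')) y
      (hasFDerivAt_prodMk_right (𝕜 := ℝ) x y).differentiableAt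
  exact (sum_apply_single_mul (fderiv ℝ (fun y' => f x y') y).toLinearMap v).trans
    ((hd.hasFDerivAt.hasLineDerivAt v).unique h)

theorem dX_eq_of_hasDerivAt {f : (ι → ℝ) → (ι → ℝ) → ℝ} (hf : SmoothOffZero f)
    {x y : ι → ℝ} (hy : y ≠ 0) {k : ι} {c : ℝ}
    (h : HasDerivAt (fun t : ℝ => f (x + t • Pi.single k 1) y) c 0) : dX k f x y = c := by
  simpa [Pi.single_apply] using sum_dX_mul_eq_of_hasDerivAt hf hy h

theorem dY_eq_of_hasDerivAt {f : (ι → ℝ) → (ι → ℝ) → ℝ} (hf : SmoothOffZero f)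
    {x y : ι → ℝ} (hy : y ≠ 0) {k : ι} {c : ℝ}
    (h : HasDerivAt (fun t : ℝ => f x (y + t • Pi.single k 1)) c 0) : dY k f x y = c := by
  simpa [Pi.single_apply] using sum_dY_mul_eq_of_hasDerivAt hf hy h

end LineDerivatives

end Finsler

/-! ### The Randers norm on a vector space: derivatives and convexity. -/

section MinkowskiNorm

variable {E : Type*} [AddCommGroup E] [Module ℝ E]

/-- The Randers norm `√h(v, v) + κ h(e, v)` on a vector space. -/
noncomputable def randersNorm (h : LinearMap.BilinForm ℝ E) (e : E) (κ : ℝ) (v : E) : ℝ :=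
  √(h v v) + κ * h e v

/-- The differential of the Randers norm at `v`. -/
noncomputable def randersDiff (h : LinearMap.BilinForm ℝ E) (e : E) (κ : ℝ) (v : E) : E →ₗ[ℝ] ℝ :=
  (√(h v v))⁻¹ • h v + κ • h e

/-- Half the second differential of the square of the Randers norm at `v`. -/
noncomputable def randersHess (h : LinearMap.BilinForm ℝ E) (e : E) (κ : ℝ) (v : E) :
    LinearMap.BilinForm ℝ E :=
  LinearMap.BilinForm.linMulLin (randersDiff h e κ v) (randersDiff h e κ v)
    + (randersNorm h e κ v / √(h v v)) • h
    - (randersNorm h e κ v / √(h v v) ^ 3) • LinearMap.BilinForm.linMulLin (h v) (h v)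

variable {h : LinearMap.BilinForm ℝ E} {e : E} {κ : ℝ}

theorem randersDiff_apply (v w : E) :
    randersDiff h e κ v w = h v w / √(h v v) + κ * h e w := by
  simp [randersDiff, div_eq_inv_mul]

theorem randersHess_apply (v u w : E) :
    randersHess h e κ v u w = randersDiff h e κ v u * randersDiff h e κ v w
      + randersNorm h e κ v / √(h v v) * h u w
      - randersNorm h e κ v / √(h v v) ^ 3 * (h v u * h v w) := by
  simp [randersHess, LinearMap.BilinForm.linMulLin]

theorem randersDiff_self (v : E) :
    randersDiff h e κ v v = randersNorm h e κ v := by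
  rw [randersDiff_apply, Real.div_sqrt, randersNorm]

/-- The Randers norm is positive, by Cauchy–Schwarz, when the drift `κ e` has length `< 1`. -/
theorem randersNorm_pos (hs : ∀ u v, h u v = h v u) (hp : ∀ u, u ≠ 0 → 0 < h u u)
    (hκ : κ ^ 2 * h e e < 1) {v : E} (hv : v ≠ 0) : 0 < randersNorm h e κ v := by
  have hvv := hp v hv
  have hcs : h e v ^ 2 ≤ h e e * h v v := by
    -- This vector is, up to the factor -h(v, v), the part of e orthogonal to v; its square length
    -- gives Cauchy–Schwarz.
    by_cases he : h e v • v - h v v • e = 0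
    · have h1 := congrArg (fun u => h e u) he
      simp only [map_sub, map_smul, smul_eq_mul, map_zero] at h1
      nlinarith
    · have h1 := hp _ he
      simp only [map_sub, map_smul, LinearMap.sub_apply, LinearMap.smul_apply, smul_eq_mul,
        hs v e] at h1
      have : 0 < h v v * (h e e * h v v - h e v ^ 2) := by nlinarith
      nlinarith [pos_of_mul_pos_right this hvv.le]
  have h2 : (κ * h e v) ^ 2 < h v v := by
    calc (κ * h e v) ^ 2 = κ ^ 2 * h e v ^ 2 := by ring
      _ ≤ κ ^ 2 * (h e e * h v v) := by gcongr
      _ = (κ ^ 2 * h e e) * h v v := by ring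
      _ < 1 * h v v := by gcongr
      _ = h v v := one_mul _
  have h3 := (Real.lt_sqrt (abs_nonneg _)).2 (by rwa [sq_abs])
  unfold randersNorm
  linarith [neg_abs_le (κ * h e v)]

/-- The Hessian is the square of the differential plus a positive multiple of the Gram determinant
of u and v. The latter vanishes only for u parallel to v, and there the differential is non-zero
because its value at v is the norm of v. -/
theorem randersHess_pos (hs : ∀ u v, h u v = h v u) (hp : ∀ u, u ≠ 0 → 0 < h u u)
    (hκ : κ ^ 2 * h e e < 1) {v u : E} (hv : v ≠ 0) (hu : u ≠ 0) :
    0 < randersHess h e κ v u u := by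
  have hvv := hp v hv
  have hN := randersNorm_pos hs hp hκ hv
  have ha : 0 < √(h v v) := Real.sqrt_pos.2 hvv
  have hsq : √(h v v) ^ 2 = h v v := Real.sq_sqrt hvv.le
  have key : randersHess h e κ v u u = randersDiff h e κ v u ^ 2
      + randersNorm h e κ v / √(h v v) ^ 3 * (h v v * h u u - h v u ^ 2) := by
    rw [randersHess_apply]
    field_simp
    linear_combination randersNorm h e κ v * h u u * hsq
  have hdec : h v v * (h v v * h u u - h v u ^ 2)
      = h (h v v • u - h v u • v) (h v v • u - h v u • v) := by
    simp only [map_sub, map_smul, LinearMap.sub_apply, LinearMap.smul_apply, smul_eq_mul, hs u v]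
    ring
  rw [key]
  by_cases hz : h v v • u - h v u • v = 0
  · have h0 : h v v * h u u - h v u ^ 2 = 0 := by
      rw [hz] at hdec
      simpa [hvv.ne'] using hdec
    have h1 : h v v * randersDiff h e κ v u = h v u * randersNorm h e κ v := by
      rw [← randersDiff_self, ← smul_eq_mul, ← map_smul, ← smul_eq_mul (h v u), ← map_smul,
        sub_eq_zero.1 hz]
    have h2 : h v u ≠ 0 := by
      intro h2
      rw [h2] at h0
      have := mul_pos hvv (hp u hu)
      nlinarith
    have h3 : randersDiff h e κ v u ≠ 0 := by
      intro h3
      rw [h3, mul_zero] at h1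
      exact mul_ne_zero h2 hN.ne' h1.symm
    rw [h0]
    positivity
  · have h1 := hp _ hz
    rw [← hdec] at h1
    have := pos_of_mul_pos_right h1 hvv.le
    positivity

theorem hasDerivAt_form_line (hs : ∀ u v, h u v = h v u) (v w : E) :
    HasDerivAt (fun t : ℝ => h (v + t • w) (v + t • w)) (2 * h v w) 0 := by
  have e1 : (fun t : ℝ => h (v + t • w) (v + t • w))
      = fun t : ℝ => h v v + t * (2 * h v w) + t ^ 2 * h w w := by
    funext t
    simp only [map_add, map_smul, LinearMap.add_apply, LinearMap.smul_apply, smul_eq_mul, hs w v]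
    ring
  rw [e1]
  have := (((hasDerivAt_id (0 : ℝ)).mul_const (2 * h v w)).const_add (h v v)).fun_add
    (((hasDerivAt_id (0 : ℝ)).fun_pow 2).mul_const (h w w))
  simpa using this

theorem hasDerivAt_linear_line (f : E →ₗ[ℝ] ℝ) (v w : E) :
    HasDerivAt (fun t : ℝ => f (v + t • w)) (f w) 0 := by
  simp only [map_add, map_smul, smul_eq_mul]
  simpa using ((hasDerivAt_id (0 : ℝ)).mul_const (f w)).const_add (f v)

theorem hasDerivAt_sqrt_form_line (hs : ∀ u v, h u v = h v u) {v : E} (hv : 0 < h v v) (w : E) :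
    HasDerivAt (fun t : ℝ => √(h (v + t • w) (v + t • w))) (h v w / √(h v v)) 0 := by
  have h1 := (hasDerivAt_form_line hs v w).sqrt (by simpa using hv.ne')
  convert h1 using 1
  simp only [zero_smul, add_zero]
  rw [mul_div_mul_left _ _ two_ne_zero]

theorem hasDerivAt_randersNorm_line (hs : ∀ u v, h u v = h v u) {v : E} (hv : 0 < h v v) (w : E) :
    HasDerivAt (fun t : ℝ => randersNorm h e κ (v + t • w)) (randersDiff h e κ v w) 0 := by
  rw [randersDiff_apply]
  exact (hasDerivAt_sqrt_form_line hs hv w).add ((hasDerivAt_linear_line (h e) v w).const_mul κ)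

theorem hasDerivAt_randersNorm_sq_line (hs : ∀ u v, h u v = h v u) {v : E} (hv : 0 < h v v)
    (w : E) : HasDerivAt (fun t : ℝ => randersNorm h e κ (v + t • w) ^ 2)
      (2 * randersNorm h e κ v * randersDiff h e κ v w) 0 := by
  simpa using (hasDerivAt_randersNorm_line (e := e) (κ := κ) hs hv w).fun_pow 2

theorem hasDerivAt_randersDiff_line (hs : ∀ u v, h u v = h v u) {v : E} (hv : 0 < h v v)
    (u w : E) : HasDerivAt (fun t : ℝ => randersDiff h e κ (v + t • u) w)
      (h u w / √(h v v) - h v u * h v w / √(h v v) ^ 3) 0 := by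
  simp only [randersDiff_apply]
  have ha : √(h v v) ≠ 0 := (Real.sqrt_pos.2 hv).ne'
  have h1 := ((hasDerivAt_linear_line (LinearMap.flip h w) v u).fun_div
    (hasDerivAt_sqrt_form_line hs hv u) (by simpa using ha)).add_const (κ * h e w)
  refine h1.congr_deriv ?_
  simp only [LinearMap.flip_apply, zero_smul, add_zero]
  field_simp

theorem hasDerivAt_randersNorm_mul_diff_line (hs : ∀ u v, h u v = h v u) {v : E}
    (hv : 0 < h v v) (u w : E) :
    HasDerivAt (fun t : ℝ => 2 * randersNorm h e κ (v + t • u) * randersDiff h e κ (v + t • u) w)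
      (2 * randersHess h e κ v u w) 0 := by
  have h1 := ((hasDerivAt_randersNorm_line (e := e) (κ := κ) hs hv u).const_mul 2).fun_mul
    (hasDerivAt_randersDiff_line (e := e) (κ := κ) hs hv u w)
  refine h1.congr_deriv ?_
  simp only [zero_smul, add_zero]
  rw [randersHess_apply]
  ring

end MinkowskiNorm

/-! ### Left-invariant Randers metrics with central drift: spray, Jacobi operator, flag curvature.
-/

namespace Finsler

section CentralRanders

variable {ι : Type*}

/-- The coframe `y ↦ y - B(x, y) e`, which moves tangent vectors at `x` to the origin by left
translation in the central extension defined by `B` with centre `e`. -/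
def coframe (B : LinearMap.BilinForm ℝ (ι → ℝ)) (e x : ι → ℝ) : (ι → ℝ) →ₗ[ℝ] (ι → ℝ) :=
  LinearMap.id - (B x).smulRight e

/-- The inverse of `coframe`. -/
def frame (B : LinearMap.BilinForm ℝ (ι → ℝ)) (e x : ι → ℝ) : (ι → ℝ) →ₗ[ℝ] (ι → ℝ) :=
  LinearMap.id + (B x).smulRight e

/-- The left-invariant Randers metric `√h(v, v) + κ h(e, v)`, `v = coframe B e x y`. -/
noncomputable def centralRanders (B h : LinearMap.BilinForm ℝ (ι → ℝ)) (e : ι → ℝ) (κ : ℝ) :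
    (ι → ℝ) → (ι → ℝ) → ℝ :=
  fun x y => randersNorm h e κ (coframe B e x y)

/-- `B` is an alternating form with `e` in its radical, `h` an inner product, `κ e` has length
`< 1`, and `A` is the operator that represents `B` with respect to `h`. -/
structure IsCentralRandersData (B h : LinearMap.BilinForm ℝ (ι → ℝ)) (e : ι → ℝ) (κ : ℝ)
    (A : (ι → ℝ) →ₗ[ℝ] (ι → ℝ)) : Prop where
  alt : ∀ u, B u u = 0
  radical : ∀ u, B e u = 0
  symm : ∀ u v, h u v = h v u
  pos : ∀ u, u ≠ 0 → 0 < h u u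
  length_lt : κ ^ 2 * h e e < 1
  represents : ∀ u v, h (A u) v = B u v

theorem coframe_apply (B : LinearMap.BilinForm ℝ (ι → ℝ)) (e x y : ι → ℝ) :
    coframe B e x y = y - B x y • e := by
  simp [coframe]

theorem frame_apply (B : LinearMap.BilinForm ℝ (ι → ℝ)) (e x y : ι → ℝ) :
    frame B e x y = y + B x y • e := by
  simp [frame]

namespace IsCentralRandersData

variable {B h : LinearMap.BilinForm ℝ (ι → ℝ)} {e : ι → ℝ} {κ : ℝ}
  {A : (ι → ℝ) →ₗ[ℝ] (ι → ℝ)}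

theorem neg (hd : IsCentralRandersData B h e κ A) (u v : ι → ℝ) : B u v = -B v u := by
  have := hd.alt (u + v)
  simp only [map_add, LinearMap.add_apply, hd.alt] at this
  linarith

theorem radical_right (hd : IsCentralRandersData B h e κ A) (u : ι → ℝ) : B u e = 0 := by
  rw [hd.neg, hd.radical, neg_zero]

theorem coframe_center (hd : IsCentralRandersData B h e κ A) (x : ι → ℝ) :
    coframe B e x e = e := by
  simp [coframe_apply, hd.radical_right]

theorem coframe_frame (hd : IsCentralRandersData B h e κ A) (x y : ι → ℝ) :
    coframe B e x (frame B e x y) = y := by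
  simp [coframe_apply, frame_apply, hd.radical_right]

theorem frame_coframe (hd : IsCentralRandersData B h e κ A) (x y : ι → ℝ) :
    frame B e x (coframe B e x y) = y := by
  simp [coframe_apply, frame_apply, hd.radical_right]

theorem coframe_ne_zero (hd : IsCentralRandersData B h e κ A) (x : ι → ℝ) {y : ι → ℝ}
    (hy : y ≠ 0) : coframe B e x y ≠ 0 := fun h0 => hy <| by
  rw [← hd.frame_coframe x y, h0, map_zero]

theorem form_coframe_pos (hd : IsCentralRandersData B h e κ A) (x : ι → ℝ) {y : ι → ℝ}
    (hy : y ≠ 0) : 0 < h (coframe B e x y) (coframe B e x y) :=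
  hd.pos _ (hd.coframe_ne_zero x hy)

theorem omega_coframe (hd : IsCentralRandersData B h e κ A) (x y u : ι → ℝ) :
    B (coframe B e x y) (coframe B e x u) = B y u := by
  simp [coframe_apply, hd.radical_right, hd.radical]

/-- h(A e, A e) = B(e, A e) = 0. This is what makes the spray vanish at central vectors. -/
theorem map_center (hd : IsCentralRandersData B h e κ A) : A e = 0 := by
  by_contra h0
  have := hd.pos _ h0
  rw [hd.represents, hd.radical] at this
  exact lt_irrefl _ this

theorem map_coframe (hd : IsCentralRandersData B h e κ A) (x y : ι → ℝ) :
    A (coframe B e x y) = A y := by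
  simp [coframe_apply, hd.map_center]

theorem form_center_map (hd : IsCentralRandersData B h e κ A) (u : ι → ℝ) : h e (A u) = 0 := by
  rw [hd.symm, hd.represents, hd.radical_right]

theorem form_self_map (hd : IsCentralRandersData B h e κ A) (u : ι → ℝ) : h u (A u) = 0 := by
  rw [hd.symm, hd.represents, hd.alt]

variable [Fintype ι]

theorem contDiff_form (h : LinearMap.BilinForm ℝ (ι → ℝ)) :
    ContDiff ℝ ∞ fun q : (ι → ℝ) × (ι → ℝ) => h q.1 q.2 :=
  ((LinearMap.toContinuousLinearMap
    (LinearMap.toContinuousLinearMap.toLinearMap ∘ₗ h)).contDiff.comp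
      contDiff_fst).clm_apply contDiff_snd

theorem contDiff_coframe (B : LinearMap.BilinForm ℝ (ι → ℝ)) (e : ι → ℝ) :
    ContDiff ℝ ∞ fun q : (ι → ℝ) × (ι → ℝ) => coframe B e q.1 q.2 := by
  simp only [coframe_apply]
  exact contDiff_snd.sub ((contDiff_form B).smul contDiff_const)

theorem smooth_sqrt (hd : IsCentralRandersData B h e κ A) :
    SmoothOffZero fun x y => √(h (coframe B e x y) (coframe B e x y)) := by
  intro x y hy
  have h1 : ContDiff ℝ ∞ fun q : (ι → ℝ) × (ι → ℝ) =>
      h (coframe B e q.1 q.2) (coframe B e q.1 q.2) :=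
    (contDiff_form h).comp ((contDiff_coframe B e).prodMk (contDiff_coframe B e))
  exact h1.contDiffAt.sqrt (hd.form_coframe_pos x hy).ne'

theorem smooth_linear (f : (ι → ℝ) →ₗ[ℝ] ℝ) :
    SmoothOffZero fun x y => f (coframe B e x y) := fun _ _ _ =>
  ((LinearMap.toContinuousLinearMap f).contDiff.comp (contDiff_coframe B e)).contDiffAt

theorem smooth_centralRanders (hd : IsCentralRandersData B h e κ A) :
    SmoothOffZero (centralRanders B h e κ) :=
  hd.smooth_sqrt.add (.const_mul κ (smooth_linear (h e)))

theorem smooth_energy (hd : IsCentralRandersData B h e κ A) :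
    SmoothOffZero (energy (centralRanders B h e κ)) :=
  (hd.smooth_centralRanders.mul hd.smooth_centralRanders).congr fun _ _ _ => sq _

variable [DecidableEq ι]

theorem dY_energy (hd : IsCentralRandersData B h e κ A) {x y : ι → ℝ} (hy : y ≠ 0) (l : ι) :
    dY l (energy (centralRanders B h e κ)) x y = 2 * randersNorm h e κ (coframe B e x y)
      * randersDiff h e κ (coframe B e x y) (coframe B e x (Pi.single l 1)) := by
  refine dY_eq_of_hasDerivAt hd.smooth_energy hy ?_
  simp only [energy, centralRanders, map_add, map_smul]
  exact hasDerivAt_randersNorm_sq_line hd.symm (hd.form_coframe_pos x hy) _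

theorem dX_energy (hd : IsCentralRandersData B h e κ A) {x y : ι → ℝ} (hy : y ≠ 0) (l : ι) :
    dX l (energy (centralRanders B h e κ)) x y = 2 * randersNorm h e κ (coframe B e x y)
      * randersDiff h e κ (coframe B e x y) (B y (Pi.single l 1) • e) := by
  refine dX_eq_of_hasDerivAt hd.smooth_energy hy ?_
  have e1 : ∀ t : ℝ, coframe B e (x + t • Pi.single l 1) y
      = coframe B e x y + t • (B y (Pi.single l 1) • e) := by
    intro t
    rw [coframe_apply, coframe_apply, hd.neg y]
    simp only [map_add, map_smul, LinearMap.add_apply, LinearMap.smul_apply, smul_eq_mul]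
    module
  simp only [energy, centralRanders, e1]
  exact hasDerivAt_randersNorm_sq_line hd.symm (hd.form_coframe_pos x hy) _

/-- Moving x in the direction y leaves `coframe` x y fixed, since B is alternating; only the
translated basis vector varies, and it does so linearly. -/
theorem sum_dX_dY_energy (hd : IsCentralRandersData B h e κ A) {x y : ι → ℝ} (hy : y ≠ 0)
    (l : ι) :
    ∑ k, dX k (dY l (energy (centralRanders B h e κ))) x y * y k
      = -(2 * randersNorm h e κ (coframe B e x y)
        * randersDiff h e κ (coframe B e x y) (B y (Pi.single l 1) • e)) := by
  refine sum_dX_mul_eq_of_hasDerivAt (hd.smooth_energy.dY l) hy ?_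
  have e1 : ∀ t : ℝ, coframe B e (x + t • y) y = coframe B e x y := by
    intro t
    simp [coframe_apply, hd.alt]
  have e2 : ∀ t : ℝ, coframe B e (x + t • y) (Pi.single l 1)
      = coframe B e x (Pi.single l 1) + t • (-(B y (Pi.single l 1) • e)) := by
    intro t
    rw [coframe_apply, coframe_apply]
    simp only [map_add, map_smul, LinearMap.add_apply, LinearMap.smul_apply, smul_eq_mul]
    module
  simp only [hd.dY_energy hy, e1, e2]
  rw [← mul_neg, ← map_neg]
  exact (hasDerivAt_linear_line _ _ _).const_mul _

theorem fundamentalTensor_eq (hd : IsCentralRandersData B h e κ A) {x y : ι → ℝ} (hy : y ≠ 0)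
    (i j : ι) : fundamentalTensor (centralRanders B h e κ) x y i j
      = randersHess h e κ (coframe B e x y) (coframe B e x (Pi.single i 1))
        (coframe B e x (Pi.single j 1)) := by
  have h1 := hasDerivAt_randersNorm_mul_diff_line (h := h) (e := e) (κ := κ) hd.symm
    (hd.form_coframe_pos x hy) (coframe B e x (Pi.single i 1)) (coframe B e x (Pi.single j 1))
  have h2 : dY i (dY j (energy (centralRanders B h e κ))) x y
      = 2 * randersHess h e κ (coframe B e x y) (coframe B e x (Pi.single i 1))
        (coframe B e x (Pi.single j 1)) := by
    have hs : SmoothOffZero fun x y => 2 * randersNorm h e κ (coframe B e x y)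
      * randersDiff h e κ (coframe B e x y) (coframe B e x (Pi.single j 1)) :=
      (hd.smooth_energy.dY j).congr fun x y hy => (hd.dY_energy hy j).symm
    rw [dY_congr (fun x y hy => hd.dY_energy hy j) i hy]
    refine dY_eq_of_hasDerivAt hs hy ?_
    simpa only [map_add, map_smul] using h1
  rw [fundamentalTensor, Matrix.of_apply, h2]
  ring

theorem sum_fundamentalTensor_mul (hd : IsCentralRandersData B h e κ A) {x y : ι → ℝ}
    (hy : y ≠ 0) (l : ι) (v : ι → ℝ) :
    ∑ j, fundamentalTensor (centralRanders B h e κ) x y l j * v j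
      = randersHess h e κ (coframe B e x y) (coframe B e x (Pi.single l 1))
        (coframe B e x v) := by
  simp only [hd.fundamentalTensor_eq hy]
  exact sum_apply_single_mul (randersHess h e κ (coframe B e x y)
    (coframe B e x (Pi.single l 1)) ∘ₗ coframe B e x) v

theorem osculating_eq (hd : IsCentralRandersData B h e κ A) {x y : ι → ℝ} (hy : y ≠ 0)
    (u v : ι → ℝ) : osculating (centralRanders B h e κ) x y u v
      = randersHess h e κ (coframe B e x y) (coframe B e x u) (coframe B e x v) := by
  have h1 : osculating (centralRanders B h e κ) x y u v
      = ∑ i, (∑ j, fundamentalTensor (centralRanders B h e κ) x y i j * v j) * u i := by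
    unfold osculating
    simp only [Finset.sum_mul]
    exact Finset.sum_congr rfl fun i _ => Finset.sum_congr rfl fun j _ => by ring
  rw [h1]
  simp only [hd.sum_fundamentalTensor_mul hy]
  exact sum_apply_single_mul (LinearMap.flip (randersHess h e κ (coframe B e x y))
    (coframe B e x v) ∘ₗ coframe B e x) u

theorem isRegular (hd : IsCentralRandersData B h e κ A) :
    IsRegular (centralRanders B h e κ) where
  smooth := hd.smooth_energy
  euler x y hy := by
    simp only [hd.dY_energy hy, mul_assoc]
    rw [← Finset.mul_sum, ← Finset.mul_sum]
    have h1 := sum_apply_single_mul (randersDiff h e κ (coframe B e x y) ∘ₗ coframe B e x) y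
    simp only [LinearMap.comp_apply] at h1
    rw [h1, randersDiff_self, energy, centralRanders, sq]
  det_ne_zero x y hy h0 := by
    obtain ⟨u, hu, hu0⟩ := Matrix.exists_mulVec_eq_zero_iff.2 h0
    have h1 := randersHess_pos (κ := κ) hd.symm hd.pos hd.length_lt (hd.coframe_ne_zero x hy)
      (hd.coframe_ne_zero x hu)
    have h2 : randersHess h e κ (coframe B e x y) (coframe B e x u) (coframe B e x u)
        = ∑ i, randersHess h e κ (coframe B e x y) (coframe B e x (Pi.single i 1))
          (coframe B e x u) * u i :=
      (sum_apply_single_mul (LinearMap.flip (randersHess h e κ (coframe B e x y))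
        (coframe B e x u) ∘ₗ coframe B e x) u).symm
    have h3 : ∀ i, randersHess h e κ (coframe B e x y) (coframe B e x (Pi.single i 1))
          (coframe B e x u) = 0 := fun i =>
      (hd.sum_fundamentalTensor_mul hy i u).symm.trans (congrFun hu0 i)
    rw [h2] at h1
    simp [h3] at h1

/-- The spray of a left-invariant Randers metric with central drift. -/
theorem spray_eq (hd : IsCentralRandersData B h e κ A) {x y : ι → ℝ} (hy : y ≠ 0) (i : ι) :
    spray (centralRanders B h e κ) i x y = -(h e (coframe B e x y)
      + κ * h e e * √(h (coframe B e x y) (coframe B e x y))) * frame B e x (A y) i := by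
  refine congrFun (hd.isRegular.ext_of_lower (x := x) hy
    (v := fun i => spray (centralRanders B h e κ) i x y)
    (w := (-(h e (coframe B e x y)
      + κ * h e e * √(h (coframe B e x y) (coframe B e x y)))) • frame B e x (A y))
    fun l => ?_) i
  -- The two terms of the spray covector agree and add up. On the other side A v is orthogonal to v
  -- and e, so the Hessian paired with A v reduces to a multiple of h.
  rw [hd.isRegular.sum_fundamentalTensor_mul_spray hy, hd.sum_dX_dY_energy hy, hd.dX_energy hy,
    hd.sum_fundamentalTensor_mul hy, map_smul (coframe B e x), hd.coframe_frame,
    ← hd.map_coframe x y,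
    ← hd.omega_coframe x y, map_smul, map_smul, smul_eq_mul, smul_eq_mul]
  set v := coframe B e x y
  set w := coframe B e x (Pi.single l 1)
  have ha : √(h v v) ≠ 0 := (Real.sqrt_pos.2 (hd.form_coframe_pos x hy)).ne'
  rw [randersHess_apply, hd.form_self_map, hd.symm w, hd.represents, randersDiff_apply v (A v),
    hd.form_self_map, hd.form_center_map, randersDiff_apply, hd.symm v e]
  field_simp
  ring

/-- Along the centre the nonlinear connection is a multiple of `A`. -/
theorem nonlinearConnection_center (hd : IsCentralRandersData B h e κ A) {w : ℝ}
    (hw : w • e ≠ 0) (x : ι → ℝ) (i k : ι) :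
    nonlinearConnection (centralRanders B h e κ) i k x (w • e) = -(h e (w • e)
      + κ * h e e * √(h (w • e) (w • e))) * frame B e x (A (Pi.single k 1)) i := by
  have hs : SmoothOffZero fun x y => -(h e (coframe B e x y)
      + κ * h e e * √(h (coframe B e x y) (coframe B e x y))) * frame B e x (A y) i :=
    (hd.isRegular.smooth_spray i).congr fun x y hy => (hd.spray_eq hy i).symm
  unfold nonlinearConnection
  rw [dY_congr (fun x y hy => hd.spray_eq hy i) k hw]
  refine dY_eq_of_hasDerivAt hs hw ?_
  -- The factor A y vanishes at the base point, so the product rule never differentiates the scalar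
  -- factor.
  simp only [map_add, map_smul, hd.coframe_center, hd.map_center, smul_zero, zero_add]
  have h1 := (((hasDerivAt_linear_line (h e) (w • e) (coframe B e x (Pi.single k 1))).fun_add
    ((hasDerivAt_sqrt_form_line hd.symm (hd.pos _ hw)
      (coframe B e x (Pi.single k 1))).const_mul (κ * h e e))).fun_neg.fun_mul
    ((hasDerivAt_id (0 : ℝ)).mul_const (frame B e x (A (Pi.single k 1)) i)))
  simp only [map_add, map_smul] at h1
  refine h1.congr_deriv ?_
  simp

/-- The Jacobi operator of a left-invariant Randers metric with central drift, in the direction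
of the centre. -/
theorem curvatureOp_center (hd : IsCentralRandersData B h e κ A) {w : ℝ}
    (hw : w • e ≠ 0) (x u : ι → ℝ) :
    curvatureOp (centralRanders B h e κ) x (w • e) u (w • e) (w • e)
      = -((h e (w • e) + κ * h e e * √(h (w • e) (w • e))) ^ 2) • frame B e x (A (A u)) := by
  funext i
  rw [hd.isRegular.curvatureOp_eq hw]
  have hG : ∀ x i, spray (centralRanders B h e κ) i x (w • e) = 0 := by
    intro x i
    simp [hd.spray_eq hw, hd.map_center]
  have hG' : ∀ k, dX k (spray (centralRanders B h e κ) i) x (w • e) = 0 := by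
    intro k
    simp [dX, hG]
  -- Moving x along the centre does not change the frame, because e lies in the radical of B.
  have hN : ∀ k, ∑ l, dX l (nonlinearConnection (centralRanders B h e κ) i k) x (w • e)
      * (w • e) l = 0 := by
    intro k
    refine sum_dX_mul_eq_of_hasDerivAt (hd.isRegular.smooth_nonlinearConnection i k) hw ?_
    simp only [hd.nonlinearConnection_center hw, frame_apply, map_add, map_smul,
      LinearMap.add_apply, LinearMap.smul_apply, hd.radical, smul_zero, add_zero]
    exact hasDerivAt_const _ _
  simp only [hG, hG', hN, hd.nonlinearConnection_center hw]
  set c := h e (w • e) + κ * h e e * √(h (w • e) (w • e))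
  have h1 : ∀ v, ∑ m, frame B e x (A (Pi.single m 1)) i * v m = frame B e x (A v) i := fun v =>
    sum_apply_single_mul (LinearMap.proj i ∘ₗ frame B e x ∘ₗ A) v
  have h2 : ∀ k, ∑ m, -c * frame B e x (A (Pi.single m 1)) i
      * (-c * frame B e x (A (Pi.single k 1)) m)
      = c ^ 2 * frame B e x (A (A (Pi.single k 1))) i := by
    intro k
    have : A (frame B e x (A (Pi.single k 1))) = A (A (Pi.single k 1)) := by
      simp [frame_apply, hd.map_center]
    rw [← this, ← h1, Finset.mul_sum]
    exact Finset.sum_congr rfl fun m _ => by ring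
  have h3 : ∑ k, frame B e x (A (A (Pi.single k 1))) i * u k = frame B e x (A (A u)) i :=
    sum_apply_single_mul (LinearMap.proj i ∘ₗ frame B e x ∘ₗ A ∘ₗ A) u
  simp only [h2, mul_zero, zero_mul, Finset.sum_const_zero, sub_zero, add_zero, zero_sub]
  rw [Pi.smul_apply, smul_eq_mul, ← h3, Finset.mul_sum]
  exact Finset.sum_congr rfl fun k _ => by ring

/-- The flag curvature with central flag pole `w e`, normalised by `h(w e, w e) = 1`. -/
theorem flagCurvature_center (hd : IsCentralRandersData B h e κ A) {w : ℝ}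
    (hw : w ^ 2 * h e e = 1) {x u v : ι → ℝ} {s t : ℝ} (hs : s ≠ 0)
    (hu : coframe B e x u = s • v + t • e) (hv : h e v = 0) :
    flagCurvature (centralRanders B h e κ) x (w • e) u = h e e * (h (A v) (A v) / h v v) := by
  have hwe : h (w • e) (w • e) = 1 := by
    rw [← hw]
    simp only [map_smul, LinearMap.smul_apply, smul_eq_mul]
    ring
  have hne : w • e ≠ 0 := by
    intro h0
    simp [h0] at hwe
  have hN : 0 < randersNorm h e κ (w • e) :=
    randersNorm_pos hd.symm hd.pos hd.length_lt hne
  have hN' : randersNorm h e κ (w • e) = 1 + κ * (w * h e e) := by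
    rw [randersNorm, hwe, Real.sqrt_one, map_smul, smul_eq_mul]
  -- With w² h(e, e) = 1 the base of the square is w h(e, e) times the Randers norm of the pole.
  have hc : (h e (w • e) + κ * h e e * √(h (w • e) (w • e))) ^ 2
      = h e e * randersNorm h e κ (w • e) ^ 2 := by
    rw [hN', hwe, Real.sqrt_one, map_smul, smul_eq_mul]
    linear_combination (h e e - κ ^ 2 * h e e ^ 2) * hw
  have hAu : A u = s • A v := by
    rw [← hd.map_coframe x u, hu]
    simp [hd.map_center]
  have hcw : coframe B e x (w • e) = w • e := by rw [map_smul, hd.coframe_center]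
  have hAv : h v (A (A v)) = -h (A v) (A v) := by
    rw [hd.symm, hd.represents, hd.neg, hd.represents]
  unfold flagCurvature
  rw [hd.curvatureOp_center hne, hd.osculating_eq hne, hd.osculating_eq hne, hd.osculating_eq hne,
    hd.osculating_eq hne, hcw, map_smul, hd.coframe_frame, hc, hu, hAu]
  -- The osculating product at the pole splits into a central part and the norm times the
  -- h-orthogonal complement.
  have hB : ∀ a b, randersHess h e κ (w • e) a b
      = (w + κ) ^ 2 * (h e a * h e b)
        + randersNorm h e κ (w • e) * (h a b - w ^ 2 * (h e a * h e b)) := by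
    intro a b
    rw [randersHess_apply, randersDiff_apply, randersDiff_apply, hwe, Real.sqrt_one]
    simp only [map_smul, LinearMap.smul_apply, smul_eq_mul]
    ring
  have hfac : (w + κ) ^ 2 = w ^ 2 * randersNorm h e κ (w • e) ^ 2 := by
    rw [hN']
    linear_combination (-(2 * κ * w) - κ ^ 2 * (w ^ 2 * h e e + 1)) * hw
  -- Numerator and denominator of the flag curvature share the factor s² N³; after expanding the
  -- target by it they can be matched separately.
  rw [show h e e * (h (A v) (A v) / h v v) = h e e * h (A v) (A v) / h v v by ring,
    ← mul_div_mul_left (h e e * h (A v) (A v)) (h v v)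
      (mul_ne_zero (pow_ne_zero 2 hs) (pow_ne_zero 3 hN.ne'))]
  set N := randersNorm h e κ (w • e)
  congr 1
  · simp only [map_smul, LinearMap.smul_apply, smul_eq_mul, hB, hd.form_center_map, map_add,
      hd.symm (A (A v)), hAv]
    ring
  · simp only [hB, hfac, map_smul, LinearMap.smul_apply, smul_eq_mul, map_add,
      LinearMap.add_apply, hv, hd.symm v e]
    linear_combination (N ^ 3 * s ^ 2 * h v v
      - (1 - N) * (w ^ 2 * h e e) * N ^ 2 * s ^ 2 * h v v) * hw

end IsCentralRandersData

end CentralRanders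

end Finsler

/-! ### Left-invariant fields and metrics on the Heisenberg group. -/

namespace Heisenberg

variable {n : ℕ}

/-- The standard symplectic form as a bilinear form on `ℝ²ⁿ × ℝ`. -/
noncomputable def sympForm (n : ℕ) : LinearMap.BilinForm ℝ (HCoord n) :=
  LinearMap.mk₂ ℝ stdSymp
    (fun x x' y => by
      simp only [stdSymp, Pi.add_apply, ← Finset.sum_add_distrib]
      exact Finset.sum_congr rfl fun i _ => by ring)
    (fun c x y => by
      simp only [stdSymp, Pi.smul_apply, smul_eq_mul, Finset.mul_sum]
      exact Finset.sum_congr rfl fun i _ => by ring)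
    (fun x y y' => by
      simp only [stdSymp, Pi.add_apply, ← Finset.sum_add_distrib]
      exact Finset.sum_congr rfl fun i _ => by ring)
    (fun c x y => by
      simp only [stdSymp, Pi.smul_apply, smul_eq_mul, Finset.mul_sum]
      exact Finset.sum_congr rfl fun i _ => by ring)

/-- The central direction. -/
def center (n : ℕ) : HCoord n := Pi.single (Sum.inr (Sum.inr ())) 1

theorem sympForm_apply (x y : HCoord n) : sympForm n x y = stdSymp x y := rfl

theorem sympForm_self (x : HCoord n) : sympForm n x x = 0 := by
  simp [sympForm_apply, stdSymp, mul_comm]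

theorem sympForm_neg (x y : HCoord n) : sympForm n x y = -sympForm n y x := by
  have h := sympForm_self (x + y)
  simp only [map_add, LinearMap.add_apply, sympForm_self] at h
  linarith

theorem sympForm_center_left (x : HCoord n) : sympForm n (center n) x = 0 := by
  simp [sympForm_apply, stdSymp, center]

theorem sympForm_center_right (x : HCoord n) : sympForm n x (center n) = 0 := by
  simp [sympForm_apply, stdSymp, center]

theorem center_ne_zero : center n ≠ 0 := by
  simp [center]

theorem leftTranslation_eq (a : Heisenberg n) (p : HCoord n) :
    leftTranslation a p = a.coord + Finsler.frame (sympForm n) (center n) a.coord p := by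
  rw [Finsler.frame_apply, leftTranslation, mul_coord, sympForm_apply, center, add_assoc,
    ← Pi.single_smul, smul_eq_mul, mul_one]

theorem fderiv_leftTranslation (a : Heisenberg n) (p u : HCoord n) :
    fderiv ℝ (leftTranslation a) p u = Finsler.frame (sympForm n) (center n) a.coord u := by
  have h : leftTranslation a = fun p => a.coord
      + LinearMap.toContinuousLinearMap (Finsler.frame (sympForm n) (center n) a.coord) p :=
    funext fun p => leftTranslation_eq a p
  rw [h, fderiv_const_add, ContinuousLinearMap.fderiv]
  rfl

theorem leftTranslation_zero (p : HCoord n) : leftTranslation ⟨p⟩ 0 = p := by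
  simp [leftTranslation_eq]

theorem IsLeftInvariantField.eq_frame {X : HCoord n → HCoord n} (hX : IsLeftInvariantField X)
    (p : HCoord n) : X p = Finsler.frame (sympForm n) (center n) p (X 0) := by
  have h := hX ⟨p⟩ 0
  rw [leftTranslation_zero, fderiv_leftTranslation] at h
  exact h.symm

theorem IsLeftInvariantMetric.eq_coframe
    {g : HCoord n → LinearMap.BilinForm ℝ (HCoord n)} (hg : IsLeftInvariantMetric g)
    (p u v : HCoord n) : g p u v = g 0 (Finsler.coframe (sympForm n) (center n) p u)
      (Finsler.coframe (sympForm n) (center n) p v) := by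
  have h := hg.invariant ⟨p⟩ 0 (Finsler.coframe (sympForm n) (center n) p u)
    (Finsler.coframe (sympForm n) (center n) p v)
  simp only [leftTranslation_zero, fderiv_leftTranslation] at h
  rw [← h]
  simp [Finsler.frame_apply, Finsler.coframe_apply, sympForm_center_right]

/-- A left-invariant field is affine in the chart: X(p) = X(0) + ω(p, X(0)) e. -/
theorem IsLeftInvariantField.fderiv_zero {X : HCoord n → HCoord n}
    (hX : IsLeftInvariantField X) (u : HCoord n) :
    fderiv ℝ X 0 u = sympForm n u (X 0) • center n := by
  have h : X = fun p => X 0 + LinearMap.toContinuousLinearMap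
      ((LinearMap.flip (sympForm n) (X 0)).smulRight (center n)) p := by
    funext p
    rw [hX.eq_frame p, Finsler.frame_apply]
    simp
  rw [h, fderiv_const_add, ContinuousLinearMap.fderiv]
  simp

/-- Both terms of the bracket contribute equally because ω is antisymmetric. The resulting 2 is the
origin of the 4 in λ/4. -/
theorem lieBracket_zero {X Y : HCoord n → HCoord n} (hX : IsLeftInvariantField X)
    (hY : IsLeftInvariantField Y) :
    VectorField.lieBracket ℝ X Y 0 = (2 * sympForm n (X 0) (Y 0)) • center n := by
  rw [VectorField.lieBracket, hY.fderiv_zero, hX.fderiv_zero, sympForm_neg (Y 0) (X 0)]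
  module

theorem sympForm_eq_zero_of_lieBracket {X Y : HCoord n → HCoord n} (hX : IsLeftInvariantField X)
    (hY : IsLeftInvariantField Y) (h : VectorField.lieBracket ℝ X Y = 0) :
    sympForm n (X 0) (Y 0) = 0 := by
  have h0 := lieBracket_zero hX hY
  rw [h, Pi.zero_apply] at h0
  have := (smul_eq_zero.1 h0.symm).resolve_right center_ne_zero
  linarith

/-- The operator that represents the symplectic form with respect to a positive form. -/
theorem exists_represents {h : LinearMap.BilinForm ℝ (HCoord n)}
    (hp : ∀ u, u ≠ 0 → 0 < h u u) :
    ∃ A : HCoord n →ₗ[ℝ] HCoord n, ∀ u v, h (A u) v = sympForm n u v := by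
  have hinj : Function.Injective h := by
    rw [← LinearMap.ker_eq_bot, LinearMap.ker_eq_bot']
    intro u hu
    by_contra h0
    have := hp u h0
    rw [hu] at this
    simp at this
  let L : HCoord n ≃ₗ[ℝ] Module.Dual ℝ (HCoord n) :=
    LinearEquiv.ofInjectiveOfFinrankEq h hinj (Subspace.dual_finrank_eq).symm
  refine ⟨L.symm.toLinearMap ∘ₗ sympForm n, fun u v => ?_⟩
  have h1 : h (L.symm (sympForm n u)) = sympForm n u := L.apply_symm_apply (sympForm n u)
  exact congrArg (fun f => f v) h1

/-- The left-invariant horizontal vector with coefficients `a`, `b`, at the origin. -/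
def horizontal (U V : Fin n → HCoord n → HCoord n) (a b : Fin n → ℝ) : HCoord n :=
  ∑ i, (a i • U i 0 + b i • V i 0)

/-! ### Linear algebra in the diagonalising frame. -/

section Diagonal

variable {g : HCoord n → LinearMap.BilinForm ℝ (HCoord n)}
  {U V : Fin n → HCoord n → HCoord n} {Z : HCoord n → HCoord n} {σ : Fin n → ℝ} {lam : ℝ}

theorem horizontal_form_U (hg : IsLeftInvariantMetric g) (hdiag : IsDiagonalIn g U V Z σ lam)
    (a b : Fin n → ℝ) (j : Fin n) : g 0 (horizontal U V a b) (U j 0) = a j * σ j := by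
  simp [horizontal, LinearMap.sum_apply, hdiag.UU, hg.symm 0 (V _ 0) (U j 0), hdiag.UV]

theorem horizontal_form_V (hdiag : IsDiagonalIn g U V Z σ lam)
    (a b : Fin n → ℝ) (j : Fin n) : g 0 (horizontal U V a b) (V j 0) = b j * σ j := by
  simp [horizontal, LinearMap.sum_apply, hdiag.VV, hdiag.UV]

theorem horizontal_form_Z (hdiag : IsDiagonalIn g U V Z σ lam)
    (a b : Fin n → ℝ) : g 0 (horizontal U V a b) (Z 0) = 0 := by
  simp [horizontal, LinearMap.sum_apply, hdiag.UZ, hdiag.VZ]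

theorem horizontal_form_self (hg : IsLeftInvariantMetric g) (hdiag : IsDiagonalIn g U V Z σ lam)
    (a b : Fin n → ℝ) : g 0 (horizontal U V a b) (horizontal U V a b)
      = ∑ i, (a i ^ 2 + b i ^ 2) * σ i := by
  conv_lhs => arg 2; rw [horizontal]
  simp only [map_sum, map_add, map_smul, smul_eq_mul, horizontal_form_U hg hdiag,
    horizontal_form_V hdiag]
  exact Finset.sum_congr rfl fun i _ => by ring

/-- The operator representing the symplectic form sends `U_i` to `(c / 2σ_i) V_i` and `V_i` to
`-(c / 2σ_i) U_i`, where `Z = c e` with the central direction `e`. -/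
theorem map_horizontal (hg : IsLeftInvariantMetric g) (hdiag : IsDiagonalIn g U V Z σ lam)
    (hframe : IsHeisenbergFrame U V Z) (hσ : ∀ i, σ i ≠ 0) {c : ℝ} (hc : Z 0 = c • center n)
    {A : HCoord n →ₗ[ℝ] HCoord n} (hA : ∀ u v, g 0 (A u) v = sympForm n u v) (a b : Fin n → ℝ) :
    A (horizontal U V a b)
      = horizontal U V (fun i => -(c / 2) * b i / σ i) (fun i => c / 2 * a i / σ i) := by
  have hUV : ∀ i j, sympForm n (U i 0) (V j 0) = if i = j then c / 2 else 0 := by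
    intro i j
    have h0 := lieBracket_zero (hframe.left_U i) (hframe.left_V j)
    rw [hframe.bracket_UV] at h0
    split_ifs at h0 ⊢ with hij
    · rw [hc] at h0
      have := smul_left_injective ℝ center_ne_zero h0
      linarith
    · have := (smul_eq_zero.1 h0.symm).resolve_right center_ne_zero
      linarith
  have hUU : ∀ i j, sympForm n (U i 0) (U j 0) = 0 := fun i j =>
    sympForm_eq_zero_of_lieBracket (hframe.left_U i) (hframe.left_U j) (hframe.bracket_UU i j)
  have hVV : ∀ i j, sympForm n (V i 0) (V j 0) = 0 := fun i j =>
    sympForm_eq_zero_of_lieBracket (hframe.left_V i) (hframe.left_V j) (hframe.bracket_VV i j)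
  have hVU : ∀ i j, sympForm n (V i 0) (U j 0) = if i = j then -(c / 2) else 0 := by
    intro i j
    rw [sympForm_neg, hUV]
    simp only [eq_comm (a := j)]
    split_ifs <;> simp
  set v' := horizontal U V (fun i => -(c / 2) * b i / σ i) (fun i => c / 2 * a i / σ i)
  -- Two vectors are compared by pairing with the frame at 0, which spans; positivity of the metric
  -- then gives equality.
  have key : g 0 (A (horizontal U V a b)) = g 0 v' := by
    refine LinearMap.ext_on_range (hframe.span_eq_top 0) ?_
    rintro (j | j | _)
    · rw [hA, Sum.elim_inl, horizontal_form_U hg hdiag, div_mul_cancel₀ _ (hσ j)]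
      simp [horizontal, LinearMap.sum_apply, hUU, hVU, mul_comm]
    · rw [hA, Sum.elim_inr, Sum.elim_inl, horizontal_form_V hdiag, div_mul_cancel₀ _ (hσ j)]
      simp [horizontal, LinearMap.sum_apply, hVV, hUV, mul_comm]
    · rw [hA, Sum.elim_inr, Sum.elim_inr, horizontal_form_Z hdiag, hc, map_smul,
        sympForm_center_right, smul_zero]
  by_contra hne
  have := hg.pos 0 _ (sub_ne_zero.2 hne)
  rw [map_sub (g 0), key, sub_self] at this
  simp at this

end Diagonal

end Heisenberg

/-! ### Translation of the data and evaluation. -/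

open Heisenberg in
theorem mainTheorem3 (n : ℕ)
    (g : HCoord n → LinearMap.BilinForm ℝ (HCoord n)) (hg : Heisenberg.IsLeftInvariantMetric g)
    (U V : Fin n → HCoord n → HCoord n) (Z : HCoord n → HCoord n)
    (hframe : Heisenberg.IsHeisenbergFrame U V Z)
    (σ : Fin n → ℝ) (lam : ℝ) (hdiag : Heisenberg.IsDiagonalIn g U V Z σ lam)
    (F : HCoord n → HCoord n → ℝ) (hF : Heisenberg.IsZRanders g Z F)
    (W : HCoord n → HCoord n) (hW : W = (1 / Real.sqrt lam) • Z)
    (a b : Fin n → ℝ) (hab : ¬ (a = 0 ∧ b = 0))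
    (Y : HCoord n → HCoord n) (hY : Y = ∑ i, (a i • U i + b i • V i))
    (p X : HCoord n)
    (hX : Submodule.span ℝ {X, W p} = Submodule.span ℝ {Y p, W p}) :
    Finsler.flagCurvature F p (W p) X
        = lam / 4 * ((∑ i, (a i ^ 2 + b i ^ 2) / σ i) / (∑ i, (a i ^ 2 + b i ^ 2) * σ i))
      ∧ 0 < Finsler.flagCurvature F p (W p) X := by
  obtain ⟨i₀, hi₀⟩ : ∃ i, 0 < a i ^ 2 + b i ^ 2 := by
    by_contra! h0
    refine hab ⟨funext fun i => ?_, funext fun i => ?_⟩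
    · have := h0 i
      exact pow_eq_zero_iff two_ne_zero |>.1 (by nlinarith [sq_nonneg (a i), sq_nonneg (b i)])
    · have := h0 i
      exact pow_eq_zero_iff two_ne_zero |>.1 (by nlinarith [sq_nonneg (a i), sq_nonneg (b i)])
  have hU0 : ∀ i, U i 0 ≠ 0 := fun i => (hframe.linearIndependent 0).ne_zero (Sum.inl i)
  have hZ0 : Z 0 ≠ 0 := (hframe.linearIndependent 0).ne_zero (Sum.inr (Sum.inr ()))
  have hσ : ∀ i, 0 < σ i := fun i => by simpa [hdiag.UU] using hg.pos 0 _ (hU0 i)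
  have hlam : 0 < lam := by simpa [hdiag.ZZ] using hg.pos 0 _ hZ0
  have hnum : 0 < ∑ i, (a i ^ 2 + b i ^ 2) / σ i :=
    Finset.sum_pos' (fun i _ => div_nonneg (by positivity) (hσ i).le)
      ⟨i₀, Finset.mem_univ _, div_pos hi₀ (hσ i₀)⟩
  have hden : 0 < ∑ i, (a i ^ 2 + b i ^ 2) * σ i :=
    Finset.sum_pos' (fun i _ => mul_nonneg (by positivity) (hσ i).le)
      ⟨i₀, Finset.mem_univ _, mul_pos hi₀ (hσ i₀)⟩
  suffices h : Finsler.flagCurvature F p (W p) X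
      = lam / 4 * ((∑ i, (a i ^ 2 + b i ^ 2) / σ i) / (∑ i, (a i ^ 2 + b i ^ 2) * σ i)) from
    ⟨h, h ▸ mul_pos (by positivity) (div_pos hnum hden)⟩
  -- Z is a bracket, hence central. The index `i₀` with a non-zero coefficient also excludes n = 0,
  -- where no bracket is available.
  obtain ⟨c, hc⟩ : ∃ c : ℝ, Z 0 = c • center n := by
    have h0 := lieBracket_zero (hframe.left_U i₀) (hframe.left_V i₀)
    rw [hframe.bracket_UV, if_pos rfl] at h0
    exact ⟨_, h0⟩
  have hc0 : c ≠ 0 := by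
    rintro rfl
    exact hZ0 (by rw [hc, zero_smul])
  have hZ : ∀ q, Z q = c • center n := by
    intro q
    rw [hframe.left_Z.eq_frame q, hc, map_smul, Finsler.frame_apply, sympForm_center_right,
      zero_smul, add_zero]
  have hlam' : lam = c ^ 2 * g 0 (center n) (center n) := by
    rw [← hdiag.ZZ 0, hc]
    simp only [map_smul, LinearMap.smul_apply, smul_eq_mul]
    ring
  obtain ⟨A, hA⟩ := exists_represents (hg.pos 0)
  obtain ⟨Q, -, hQZ, hQlt, rfl⟩ := hF
  obtain ⟨q, rfl⟩ := Submodule.mem_span_singleton.1 hQZ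
  -- Q = q Z and Z = c e, so the drift is q c times the central direction.
  have hd : Finsler.IsCentralRandersData (sympForm n) (g 0) (center n) (q * c) A :=
    { alt := sympForm_self
      radical := sympForm_center_left
      symm := hg.symm 0
      pos := hg.pos 0
      length_lt := by
        have h1 := hQlt 0
        rw [Real.sqrt_lt' one_pos, Pi.smul_apply, hc] at h1
        simp only [map_smul, LinearMap.smul_apply, smul_eq_mul] at h1
        linarith
      represents := hA }
  have hFeq : randers g (q • Z) = Finsler.centralRanders (sympForm n) (g 0) (center n) (q * c) := by
    funext x y
    simp only [randers, Finsler.centralRanders, randersNorm]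
    rw [hg.eq_coframe x y y, hg.eq_coframe x _ y, Pi.smul_apply, hZ, smul_smul, map_smul,
      hd.coframe_center, map_smul, LinearMap.smul_apply, smul_eq_mul]
  have hWp : W p = (c / √lam) • center n := by
    rw [hW, Pi.smul_apply, hZ, smul_smul]
    congr 1
    ring
  have hw : (c / √lam) ^ 2 * g 0 (center n) (center n) = 1 := by
    rw [div_pow, Real.sq_sqrt hlam.le, div_mul_eq_mul_div, ← hlam', div_self hlam.ne']
  have hYp : Finsler.coframe (sympForm n) (center n) p (Y p) = horizontal U V a b := by
    have : Y p = Finsler.frame (sympForm n) (center n) p (horizontal U V a b) := by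
      rw [hY, horizontal, map_sum, Finset.sum_apply]
      refine Finset.sum_congr rfl fun i _ => ?_
      rw [Pi.add_apply, Pi.smul_apply, Pi.smul_apply, (hframe.left_U i).eq_frame p,
        (hframe.left_V i).eq_frame p, map_add, map_smul, map_smul]
    rw [this, hd.coframe_frame]
  have hev : g 0 (center n) (horizontal U V a b) = 0 := by
    have := horizontal_form_Z hdiag a b
    rw [hc, map_smul, hg.symm, smul_eq_mul] at this
    exact (mul_eq_zero.1 this).resolve_left hc0
  obtain ⟨s, t, hst⟩ : ∃ s t : ℝ, s • Y p + t • W p = X := by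
    rw [← Submodule.mem_span_pair, ← hX]
    exact Submodule.subset_span (by simp)
  -- Otherwise X would be central, and the flag would make Y p central too; pairing with its own
  -- horizontal vector would then give 0 for the positive `hden`.
  have hs : s ≠ 0 := by
    rintro rfl
    obtain ⟨s', t', hst'⟩ : ∃ s t : ℝ, s • X + t • W p = Y p := by
      rw [← Submodule.mem_span_pair, hX]
      exact Submodule.subset_span (by simp)
    rw [← hst, hWp] at hst'
    have h1 := congrArg (fun u => g 0 (Finsler.coframe (sympForm n) (center n) p u)
      (horizontal U V a b)) hst'
    simp only [hYp, horizontal_form_self hg hdiag, zero_smul, zero_add, map_add, map_smul,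
      hd.coframe_center, LinearMap.add_apply, LinearMap.smul_apply, hev, smul_zero,
      add_zero] at h1
    exact hden.ne h1
  have hXp : Finsler.coframe (sympForm n) (center n) p X
      = s • horizontal U V a b + (t * (c / √lam)) • center n := by
    rw [← hst, map_add, map_smul, map_smul, hYp, hWp, map_smul, hd.coframe_center, smul_smul]
  rw [hFeq, hWp, hd.flagCurvature_center hw hs hXp hev,
    map_horizontal hg hdiag hframe (fun i => (hσ i).ne') hc hA, horizontal_form_self hg hdiag,
    horizontal_form_self hg hdiag, hlam']
  have hsum : ∑ i, ((-(c / 2) * b i / σ i) ^ 2 + (c / 2 * a i / σ i) ^ 2) * σ i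
      = c ^ 2 / 4 * ∑ i, (a i ^ 2 + b i ^ 2) / σ i := by
    rw [Finset.mul_sum]
    refine Finset.sum_congr rfl fun i _ => ?_
    have := (hσ i).ne'
    field_simp
    ring
  rw [hsum]
  ring
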